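/- Terms of the distant call-by-name calculus dCBN are $M,N ::= x \mid \lambda x\,M \mid M\,N \mid M[N/x]$, up to $\alpha$-equivalence, where $x$ is bound in $M$ in both $\lambda x\,M$ and the explicit substitution $M[N/x]$. List contexts are $L ::= \square \mid L[N/x]$. The reduction $\to_n$ is the closure under all contexts of $L\langle\lambda x\,M\rangle\,N \to_n L\langle M[N/x]\rangle$ (the free variables of $N$ not being captured by $L$) and $M[N/x]\to_n M\{N/x\}$ (capture-avoiding substitution). Testing contexts are $T ::= \square \mid T\,N \mid (\lambda x\,T)\,N$, and $T\langle M\rangle$ denotes hole filling, which may capture free variables of $M$. A term $M$ is *dCBN-meaningful* (solvable) if $T\langle M\rangle\to_n^*\lambda x\,x$ for some testing context $T$. Resource terms are $m,n ::= x \mid \lambda x\,m \mid m\,n \mid [m_1,\dots,m_k] \mid \mathrm{der}\,m \mid m[n/x]$, where $k\ge 0$ and $[m_1,\dots,m_k]$ is a finite multiset; list contexts are $l ::= \square \mid l[n/x]$. A resource term reduces to a resource term or to $\emptyset$, by the closure under all contexts (also inside multisets, and with $\emptyset$ absorbing: $c\langle\emptyset\rangle=\emptyset$ for every context $c$) of the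 following rules, where $l$ captures no free variable of a term that was outside its scope: - $l\langle\lambda x\,m\rangle\,n\to l\langle m[n/x]\rangle$; - $\mathrm{der}(l\langle[n]\rangle)\to l\langle n\rangle$, and $\mathrm{der}(l\langle[n_1,\dots,n_k]\rangle)\to\emptyset$ if $k\neq1$; - if $x$ has exactly $k$ free occurrences $x_1,\dots,x_k$ in $m$, then $m[l\langle[p_1,\dots,p_k]\rangle/x]\to l\langle m\{p_{\sigma(1)}/x_1,\dots,p_{\sigma(k)}/x_k\}\rangle$ for every permutation $\sigma$ of $\{1,\dots,k\}$; if the number of free occurrences of $x$ in $m$ is not $k$, then $m[l\langle[p_1,\dots,p_k]\rangle/x]\to\emptyset$. A resource term is *normal* if it reduces neither to a term nor to $\emptyset$. The approximation relation $m\lhd M$ between resource terms and dCBN terms is defined inductively: $x\lhd x$; if $m\lhd M$ then $\lambda x\,m\lhd\lambda x\,M$; if $m\lhd M$, $k\ge0$ and $n_i\lhd N$ for all $1\le i\le k$, then $m\,[n_1,\dots,n_k]\lhd M\,N$ and $m[[n_1,\dots,n_k]/x]\lhd M[N/x]$. The *Taylor normal form* of $M$ is the set of all normal resource terms $n$ such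 that $m\to^* n$ for some $m\lhd M$. **Corollary.** A dCBN term $M$ is dCBN-meaningful if and only if its Taylor normal form is non-empty. -/

import Mathlib

/-! Bound variables are represented by de Bruijn indices, so that syntactic equality is
`α`-equivalence; the free variables of a term are its dangling indices.  `upr f` is the renaming
`f` pushed under one binder. -/

def upr (f : ℕ → ℕ) : ℕ → ℕ
  | 0 => 0
  | n + 1 => f n + 1

/-! ### The distant call-by-name calculus dCBN -/

/-- Terms `M, N ::= x | λx M | M N | M[N/x]`.  In `sub M N` (the explicit substitution `M[N/x]`)
the index `0` is bound in `M`, and `N` is outside of the scope of the binder. -/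
inductive DTerm : Type
  | var : ℕ → DTerm
  | lam : DTerm → DTerm
  | app : DTerm → DTerm → DTerm
  | sub : DTerm → DTerm → DTerm

namespace DTerm

/-- Renaming of free variables. -/
def rename : DTerm → (ℕ → ℕ) → DTerm
  | var i, f => var (f i)
  | lam M, f => lam (M.rename (upr f))
  | app M N, f => app (M.rename f) (N.rename f)
  | sub M N, f => sub (M.rename (upr f)) (N.rename f)

/-- Weakening by `k` binders. -/
def lift (k : ℕ) (M : DTerm) : DTerm := M.rename (· + k)

/-- A parallel substitution pushed under one binder. -/
def ups (σ : ℕ → DTerm) : ℕ → DTerm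
  | 0 => var 0
  | n + 1 => (σ n).lift 1

/-- Parallel capture-avoiding substitution. -/
def psubst : DTerm → (ℕ → DTerm) → DTerm
  | var i, σ => σ i
  | lam M, σ => lam (M.psubst (ups σ))
  | app M N, σ => app (M.psubst σ) (N.psubst σ)
  | sub M N, σ => sub (M.psubst (ups σ)) (N.psubst σ)

/-- The substitution `M{N/x}`, where `x` is the index `0` of `M` (and this binder disappears). -/
def inst (M N : DTerm) : DTerm :=
  M.psubst (fun i => match i with
    | 0 => N
    | j + 1 => var j)

/-- `plug L M` is `L⟨M⟩` for the list context `L ::= □ | L[N/x]`, given by the list of the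
arguments of its explicit substitutions, the outermost one first. -/
def plug (L : List DTerm) (M : DTerm) : DTerm :=
  L.foldr (fun N t => sub t N) M

/-- The reduction of dCBN: the closure under arbitrary contexts of
`L⟨λx M⟩ N → L⟨M[N/x]⟩` and `M[N/x] → M{N/x}`. -/
inductive Step : DTerm → DTerm → Prop
  | beta (L : List DTerm) (M N : DTerm) :
      Step (app (plug L (lam M)) N) (plug L (sub M (N.lift L.length)))
  | subst (M N : DTerm) : Step (sub M N) (M.inst N)
  | lam {M M' : DTerm} : Step M M' → Step (lam M) (lam M')
  | appL {M M' : DTerm} (N : DTerm) : Step M M' → Step (app M N) (app M' N)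
  | appR (M : DTerm) {N N' : DTerm} : Step N N' → Step (app M N) (app M N')
  | subL {M M' : DTerm} (N : DTerm) : Step M M' → Step (sub M N) (sub M' N)
  | subR (M : DTerm) {N N' : DTerm} : Step N N' → Step (sub M N) (sub M N')

/-- The reflexive transitive closure of the reduction of dCBN. -/
def Reduces : DTerm → DTerm → Prop := Relation.ReflTransGen Step

/-- Testing contexts `T ::= □ | T N | (λx T) N`. -/
inductive TestCtx : Type
  | hole : TestCtx
  | app : TestCtx → DTerm → TestCtx
  | lamApp : TestCtx → DTerm → TestCtx

/-- `T.fill M` is `T⟨M⟩`; the binders of `T` above the hole capture free variables of `M`. -/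
def TestCtx.fill : TestCtx → DTerm → DTerm
  | .hole, M => M
  | .app T N, M => DTerm.app (T.fill M) N
  | .lamApp T N, M => DTerm.app (DTerm.lam (T.fill M)) N

/-- dCBN-meaningfulness (solvability): `T⟨M⟩ →* λx x` for some testing context `T`. -/
def Meaningful (M : DTerm) : Prop :=
  ∃ T : TestCtx, Reduces (T.fill M) (lam (var 0))

end DTerm

/-! ### Resource terms

`m, n ::= x | λx m | m n | [m₁, …, mₖ] | der m | m[n/x]`, where `[m₁, …, mₖ]` is a finite multiset.
`RShape X` is one layer of this syntax; the type of resource terms is its least fixed point. -/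

/-- One layer of the syntax of resource terms, with immediate subterms in `X`. -/
inductive RShape (X : Type) : Type
  | var : ℕ → RShape X
  | lam : X → RShape X
  | app : X → X → RShape X
  | bag : Multiset X → RShape X
  | der : X → RShape X
  | sub : X → X → RShape X

namespace RShape

/-- Apply a function to all immediate subterms. -/
def map {X Y : Type} (f : X → Y) : RShape X → RShape Y
  | var i => var i
  | lam m => lam (f m)
  | app m n => app (f m) (f n)
  | bag s => bag (s.map f)
  | der m => der (f m)
  | sub m n => sub (f m) (f n)

/-- The polynomial functor with lists in place of multisets. -/
def poly : PFunctor.{0, 0} where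
  A := RShape Unit
  B
    | var _ => Fin 0
    | lam _ => Fin 1
    | app _ _ => Fin 2
    | bag s => Fin (Multiset.card s)
    | der _ => Fin 1
    | sub _ _ => Fin 2

/-- Forget the order of the elements of bags. -/
def ofPoly {X : Type} : poly X → RShape X
  | ⟨var i, _⟩ => var i
  | ⟨lam _, f⟩ => lam (f (0 : Fin 1))
  | ⟨app _ _, f⟩ => app (f (0 : Fin 2)) (f (1 : Fin 2))
  | ⟨bag s, f⟩ => bag (List.ofFn (n := Multiset.card s) f : Multiset X)
  | ⟨der _, f⟩ => der (f (0 : Fin 1))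
  | ⟨sub _ _, f⟩ => sub (f (0 : Fin 2)) (f (1 : Fin 2))

theorem ofPoly_surjective {X : Type} : Function.Surjective (ofPoly (X := X)) := by
  intro x
  cases x with
  | var i => exact ⟨⟨var i, Fin.elim0⟩, rfl⟩
  | lam m => exact ⟨⟨lam (), fun _ => m⟩, rfl⟩
  | app m n => exact ⟨⟨app () (), fun i : Fin 2 => if i = 0 then m else n⟩, rfl⟩
  | bag s =>
    obtain ⟨l, rfl⟩ := Quot.exists_rep s
    have hc : Multiset.card (Multiset.replicate l.length ()) = l.length :=
      Multiset.card_replicate _ _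
    refine ⟨⟨bag (Multiset.replicate l.length ()), fun i => l.get (Fin.cast hc i)⟩, ?_⟩
    have h : ∀ (k : ℕ) (hk : k = l.length), List.ofFn (fun i : Fin k => l.get (Fin.cast hk i)) = l := by
      rintro k rfl
      exact List.ofFn_get l
    exact congrArg (fun l : List X => bag (l : Multiset X)) (h _ hc)
  | der m => exact ⟨⟨der (), fun _ => m⟩, rfl⟩
  | sub m n => exact ⟨⟨sub () (), fun i : Fin 2 => if i = 0 then m else n⟩, rfl⟩

noncomputable instance : QPF RShape where
  map := RShape.map
  P := poly
  abs := ofPoly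
  repr x := Classical.choose (ofPoly_surjective x)
  abs_repr x := Classical.choose_spec (ofPoly_surjective x)
  abs_map f p := by
    obtain ⟨a, g⟩ := p
    cases a with
    | bag s =>
      have h : List.ofFn (n := Multiset.card s) (fun i => f (g i)) =
          (List.ofFn (n := Multiset.card s) g).map f := List.map_ofFn.symm
      exact congrArg (fun l => RShape.bag (Multiset.ofList l)) h
    | _ => rfl

theorem fmap_eq {X Y : Type} (f : X → Y) (x : RShape X) : f <$> x = x.map f := rfl

end RShape

/-- Resource terms, up to the order of the elements of bags. -/
def RTerm : Type := QPF.Fix RShape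

namespace RTerm

noncomputable section

def mk (x : RShape RTerm) : RTerm := QPF.Fix.mk x

def var (i : ℕ) : RTerm := mk (.var i)
/-- `λx m`, where `x` is the index `0` of `m`. -/
def lam (m : RTerm) : RTerm := mk (.lam m)
def app (m n : RTerm) : RTerm := mk (.app m n)
/-- The finite multiset `[m₁, …, mₖ]`. -/
def bag (s : Multiset RTerm) : RTerm := mk (.bag s)
def der (m : RTerm) : RTerm := mk (.der m)
/-- `m[n/x]`, where `x` is the index `0` of `m`. -/
def sub (m n : RTerm) : RTerm := mk (.sub m n)

/-- The constructors are jointly injective. -/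
theorem mk_injective : Function.Injective mk := by
  intro x y h
  exact ((QPF.Fix.dest_mk x).symm.trans (congrArg QPF.Fix.dest h)).trans (QPF.Fix.dest_mk y)

/-- Structural induction on resource terms. -/
theorem induction {p : RTerm → Prop} (hvar : ∀ i, p (var i)) (hlam : ∀ m, p m → p (lam m))
    (happ : ∀ m n, p m → p n → p (app m n)) (hbag : ∀ s, (∀ m ∈ s, p m) → p (bag s))
    (hder : ∀ m, p m → p (der m)) (hsub : ∀ m n, p m → p n → p (sub m n)) (m : RTerm) : p m := by
  refine QPF.Fix.ind p (fun x hx => ?_) m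
  obtain ⟨y, rfl⟩ := hx
  cases y with
  | var i => exact hvar i
  | lam a => exact hlam _ a.2
  | app a b => exact happ _ _ a.2 b.2
  | bag s =>
    refine hbag _ (fun m hm => ?_)
    obtain ⟨a, _, rfl⟩ := Multiset.mem_map.1 hm
    exact a.2
  | der a => exact hder _ a.2
  | sub a b => exact hsub _ _ a.2 b.2

/-- Structural recursion on resource terms. -/
def fold {α : Type} (g : RShape α → α) : RTerm → α := QPF.Fix.rec g

theorem fold_mk {α : Type} (g : RShape α → α) (x : RShape RTerm) :
    fold g (mk x) = g (x.map (fold g)) := QPF.Fix.rec_eq g x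

/-- One layer of `rename`. -/
def renameLayer : RShape ((ℕ → ℕ) → RTerm) → (ℕ → ℕ) → RTerm
  | .var i, f => var (f i)
  | .lam m, f => lam (m (upr f))
  | .app m n, f => app (m f) (n f)
  | .bag s, f => bag (s.map (fun m => m f))
  | .der m, f => der (m f)
  | .sub m n, f => sub (m (upr f)) (n f)

/-- Renaming of free variables; see the equations below. -/
def rename (m : RTerm) (f : ℕ → ℕ) : RTerm := fold renameLayer m f

theorem rename_var (i : ℕ) (f : ℕ → ℕ) : (var i).rename f = var (f i) := by
  simp only [rename, var, fold_mk, RShape.map, renameLayer]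

theorem rename_lam (m : RTerm) (f : ℕ → ℕ) : (lam m).rename f = lam (m.rename (upr f)) := by
  simp only [rename, lam, fold_mk, RShape.map, renameLayer]

theorem rename_app (m n : RTerm) (f : ℕ → ℕ) :
    (app m n).rename f = app (m.rename f) (n.rename f) := by
  simp only [rename, app, fold_mk, RShape.map, renameLayer]

theorem rename_bag (s : Multiset RTerm) (f : ℕ → ℕ) :
    (bag s).rename f = bag (s.map (fun m => m.rename f)) := by
  simp only [rename, bag, fold_mk, RShape.map, renameLayer, Multiset.map_map, Function.comp_def]

theorem rename_der (m : RTerm) (f : ℕ → ℕ) : (der m).rename f = der (m.rename f) := by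
  simp only [rename, der, fold_mk, RShape.map, renameLayer]

theorem rename_sub (m n : RTerm) (f : ℕ → ℕ) :
    (sub m n).rename f = sub (m.rename (upr f)) (n.rename f) := by
  simp only [rename, sub, fold_mk, RShape.map, renameLayer]

/-- One layer of `occ`. -/
def occLayer : RShape (ℕ → ℕ) → ℕ → ℕ
  | .var i, d => if i = d then 1 else 0
  | .lam m, d => m (d + 1)
  | .app m n, d => m d + n d
  | .bag s, d => (s.map (fun m => m d)).sum
  | .der m, d => m d
  | .sub m n, d => m (d + 1) + n d

/-- The number of free occurrences of the variable `d` in `m`; see the equations below. -/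
def occ (m : RTerm) (d : ℕ) : ℕ := fold occLayer m d

theorem occ_var (i d : ℕ) : (var i).occ d = if i = d then 1 else 0 := by
  simp only [occ, var, fold_mk, RShape.map, occLayer]

theorem occ_lam (m : RTerm) (d : ℕ) : (lam m).occ d = m.occ (d + 1) := by
  simp only [occ, lam, fold_mk, RShape.map, occLayer]

theorem occ_app (m n : RTerm) (d : ℕ) : (app m n).occ d = m.occ d + n.occ d := by
  simp only [occ, app, fold_mk, RShape.map, occLayer]

theorem occ_bag (s : Multiset RTerm) (d : ℕ) :
    (bag s).occ d = (s.map (fun m => m.occ d)).sum := by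
  simp only [occ, bag, fold_mk, RShape.map, occLayer, Multiset.map_map, Function.comp_def]

theorem occ_der (m : RTerm) (d : ℕ) : (der m).occ d = m.occ d := by
  simp only [occ, der, fold_mk, RShape.map, occLayer]

theorem occ_sub (m n : RTerm) (d : ℕ) : (sub m n).occ d = m.occ (d + 1) + n.occ d := by
  simp only [occ, sub, fold_mk, RShape.map, occLayer]

/-- Weakening by `k` binders. -/
def lift (k : ℕ) (m : RTerm) : RTerm := m.rename (· + k)

/-- `plug l m` is `l⟨m⟩` for the list context `l ::= □ | l[n/x]`, given by the list of the
arguments of its explicit substitutions, the outermost one first. -/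
def plug (l : List RTerm) (m : RTerm) : RTerm :=
  l.foldr (fun n t => sub t n) m

end

/-- `LinSubst d ps m r`: the term `r` is `m{p_σ(1)/x₁, …, p_σ(k)/xₖ}` for some permutation `σ`,
where `ps = [p₁, …, pₖ]` and `x₁, …, xₖ` are the occurrences in `m` of the variable `d`, which
disappears: each occurrence is replaced by exactly one element of `ps`, and each element of `ps`
is used exactly once. -/
inductive LinSubst : ℕ → Multiset RTerm → RTerm → RTerm → Prop
  | var_eq (d : ℕ) (p : RTerm) : LinSubst d {p} (var d) (p.lift d)
  | var_lt {d i : ℕ} : i < d → LinSubst d 0 (var i) (var i)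
  | var_gt {d i : ℕ} : d ≤ i → LinSubst d 0 (var (i + 1)) (var i)
  | lam {d : ℕ} {ps : Multiset RTerm} {m r : RTerm} :
      LinSubst (d + 1) ps m r → LinSubst d ps (lam m) (lam r)
  | app {d : ℕ} {ps qs : Multiset RTerm} {m r n t : RTerm} :
      LinSubst d ps m r → LinSubst d qs n t → LinSubst d (ps + qs) (app m n) (app r t)
  | bag_nil (d : ℕ) : LinSubst d 0 (bag 0) (bag 0)
  | bag_cons {d : ℕ} {ps qs : Multiset RTerm} {m r : RTerm} {s t : Multiset RTerm} :
      LinSubst d ps m r → LinSubst d qs (bag s) (bag t) →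
        LinSubst d (ps + qs) (bag (m ::ₘ s)) (bag (r ::ₘ t))
  | der {d : ℕ} {ps : Multiset RTerm} {m r : RTerm} :
      LinSubst d ps m r → LinSubst d ps (der m) (der r)
  | sub {d : ℕ} {ps qs : Multiset RTerm} {m r n t : RTerm} :
      LinSubst (d + 1) ps m r → LinSubst d qs n t → LinSubst d (ps + qs) (sub m n) (sub r t)

/-- The reduction of resource terms: `RStep m (some n)` means that `m` reduces to the term `n`, and
`RStep m none` that `m` reduces to `∅`.  It is the closure under arbitrary contexts (inside bags
too), with `∅` absorbing, of
* `l⟨λx m⟩ n → l⟨m[n/x]⟩`,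
* `der (l⟨[n]⟩) → l⟨n⟩`, and `der (l⟨[n₁, …, nₖ]⟩) → ∅` if `k ≠ 1`,
* `m[l⟨[p₁, …, pₖ]⟩/x] → l⟨m{p_σ(1)/x₁, …, p_σ(k)/xₖ}⟩` for every permutation `σ` if `x` has exactly
  `k` free occurrences `x₁, …, xₖ` in `m`, and `m[l⟨[p₁, …, pₖ]⟩/x] → ∅` otherwise. -/
inductive RStep : RTerm → Option RTerm → Prop
  | beta (l : List RTerm) (m n : RTerm) :
      RStep (app (plug l (lam m)) n) (some (plug l (sub m (n.lift l.length))))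
  | der_one (l : List RTerm) (n : RTerm) : RStep (der (plug l (bag {n}))) (some (plug l n))
  | der_zero (l : List RTerm) (s : Multiset RTerm) : Multiset.card s ≠ 1 →
      RStep (der (plug l (bag s))) none
  | sub_subst (l : List RTerm) (m r : RTerm) (ps : Multiset RTerm) :
      LinSubst 0 ps (m.rename (upr (· + l.length))) r →
        RStep (sub m (plug l (bag ps))) (some (plug l r))
  | sub_zero (l : List RTerm) (m : RTerm) (ps : Multiset RTerm) : m.occ 0 ≠ Multiset.card ps →
      RStep (sub m (plug l (bag ps))) none
  | lam {m : RTerm} {r : Option RTerm} : RStep m r → RStep (lam m) (r.map lam)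
  | appL {m : RTerm} {r : Option RTerm} (n : RTerm) : RStep m r →
      RStep (app m n) (r.map (fun m' => app m' n))
  | appR (m : RTerm) {n : RTerm} {r : Option RTerm} : RStep n r →
      RStep (app m n) (r.map (fun n' => app m n'))
  | bag {m : RTerm} {r : Option RTerm} (s : Multiset RTerm) : RStep m r →
      RStep (bag (m ::ₘ s)) (r.map (fun m' => bag (m' ::ₘ s)))
  | der {m : RTerm} {r : Option RTerm} : RStep m r → RStep (der m) (r.map der)
  | subL {m : RTerm} {r : Option RTerm} (n : RTerm) : RStep m r →
      RStep (sub m n) (r.map (fun m' => sub m' n))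
  | subR (m : RTerm) {n : RTerm} {r : Option RTerm} : RStep n r →
      RStep (sub m n) (r.map (fun n' => sub m n'))

/-- Iterated reduction between resource terms (never going through `∅`). -/
def Reduces : RTerm → RTerm → Prop :=
  Relation.ReflTransGen (fun m n => RStep m (some n))

/-- A resource term is normal if it has no reduct at all (neither a term nor `∅`). -/
def Normal (m : RTerm) : Prop := ∀ r : Option RTerm, ¬ RStep m r

/-- The approximation relation between resource terms and terms of dCBN. -/
inductive Approx : RTerm → DTerm → Prop
  | var (i : ℕ) : Approx (var i) (DTerm.var i)
  | lam {m : RTerm} {M : DTerm} : Approx m M → Approx (lam m) (DTerm.lam M)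
  | app {m : RTerm} {M N : DTerm} {s : Multiset RTerm} : Approx m M → (∀ n ∈ s, Approx n N) →
      Approx (app m (bag s)) (DTerm.app M N)
  | sub {m : RTerm} {M N : DTerm} {s : Multiset RTerm} : Approx m M → (∀ n ∈ s, Approx n N) →
      Approx (sub m (bag s)) (DTerm.sub M N)

end RTerm

/-- The Taylor expansion of a term of dCBN: the set of its resource approximants. -/
def DTerm.taylor (M : DTerm) : Set RTerm := {m | RTerm.Approx m M}

/-- The Taylor normal form of a term of dCBN: the set of the normal forms of its resource
approximants. -/
def DTerm.taylorNF (M : DTerm) : Set RTerm :=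
  {n | RTerm.Normal n ∧ ∃ m ∈ M.taylor, RTerm.Reduces m n}

/-! Both conditions are shown equivalent to typability of `M` with non-idempotent intersection
types, and to the existence of a head normal form.

From approximants to types: a normal call-by-name resource term is typable (`CBN.typed_of_normal`),
and types pull back along resource reduction (`RStep.cbn_typed`, resting on `LinSubst.typed`). A
typing of an approximant is also a typing of the approximated term (`Typed.dtyped`). So an
approximant that reaches a normal form makes its term typable (`Approx.exists_dtyped`).

From types to head normal forms: types count uses, so linear substitution of derivations does not
increase their size (`DTyped.psubst_single`), and each head step strictly decreases it
(`DTyped.progress`). No confluence or standardization argument is needed.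

From head normal forms to both sides: feeding the head variable a term that erases all its arguments
passes a test (`Hnf.meaningful`), while replacing every argument by the empty bag gives a normal
approximant (`Hnf.exists_normal`). The latter is carried back to `M` by backward simulation: an
approximant of a reduct is a reduct of an approximant (`Approx.of_reduces`).

If `M` is meaningful, backward simulation applied to `T⟨M⟩` and the identity makes `T⟨M⟩` typable,
hence `M` too, since `M` sits in head position in `T⟨M⟩`. -/

/-! ### Intersection types and typing contexts -/

/-- Non-idempotent intersection types: `arr [σ₁, …, σₖ] τ` is the type of the functions that use
their argument `k` times, with the types `σ₁, …, σₖ`. -/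
inductive Ty : Type
  | base : Ty
  | arr : List Ty → Ty → Ty

/-- A typing context: the multiset of the typed occurrences of free variables. -/
abbrev Ctx : Type := Multiset (ℕ × Ty)

namespace Ctx

/-- The types given to the variable `d`. -/
def types (d : ℕ) (Γ : Ctx) : Multiset Ty :=
  Γ.filterMap (fun p => if p.1 = d then some p.2 else none)

/-- The context without the variable `d`, whose index disappears. -/
def drop (d : ℕ) (Γ : Ctx) : Ctx :=
  Γ.filterMap (fun p => if p.1 < d then some p else if p.1 = d then none else some (p.1 - 1, p.2))

/-- Renaming of the variables of a context. -/
def rename (f : ℕ → ℕ) (Γ : Ctx) : Ctx := Γ.map (fun p => (f p.1, p.2))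

theorem types_add (d : ℕ) (Γ Δ : Ctx) : types d (Γ + Δ) = types d Γ + types d Δ :=
  Multiset.filterMap_add _ _ _

theorem drop_add (d : ℕ) (Γ Δ : Ctx) : drop d (Γ + Δ) = drop d Γ + drop d Δ :=
  Multiset.filterMap_add _ _ _

theorem rename_add (f : ℕ → ℕ) (Γ Δ : Ctx) : rename f (Γ + Δ) = rename f Γ + rename f Δ :=
  Multiset.map_add _ _ _

@[simp] theorem types_zero (d : ℕ) : types d 0 = 0 := rfl
@[simp] theorem drop_zero (d : ℕ) : drop d 0 = 0 := rfl
@[simp] theorem rename_zero (f : ℕ → ℕ) : rename f 0 = 0 := rfl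

theorem types_singleton (d i : ℕ) (τ : Ty) :
    types d {(i, τ)} = if i = d then {τ} else 0 := by
  by_cases h : i = d <;> simp [types, ← Multiset.cons_zero, h]

theorem drop_singleton (d i : ℕ) (τ : Ty) :
    drop d {(i, τ)} = if i < d then {(i, τ)} else if i = d then 0 else {(i - 1, τ)} := by
  by_cases h : i < d <;> by_cases h' : i = d <;>
    simp [drop, ← Multiset.cons_zero, h, h']

theorem rename_singleton (f : ℕ → ℕ) (i : ℕ) (τ : Ty) : rename f {(i, τ)} = {(f i, τ)} := rfl

/-- Additive maps on contexts that agree on singletons are equal. -/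
theorem additive_ext {A : Type} [AddCommMonoid A] {F G : Ctx → A} (hF : F 0 = 0) (hG : G 0 = 0)
    (hFa : ∀ Γ Δ, F (Γ + Δ) = F Γ + F Δ) (hGa : ∀ Γ Δ, G (Γ + Δ) = G Γ + G Δ)
    (h : ∀ i τ, F {(i, τ)} = G {(i, τ)}) (Γ : Ctx) : F Γ = G Γ := by
  induction Γ using Multiset.induction_on with
  | empty => rw [hF, hG]
  | cons p Γ ih => rw [← Multiset.singleton_add, hFa, hGa, ih, h p.1 p.2]

/-! ### Commutation of `types`, `drop` and `rename`, checked on singletons by additivity. -/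

theorem types_zero_rename_upr (f : ℕ → ℕ) (Γ : Ctx) : types 0 (rename (upr f) Γ) = types 0 Γ := by
  refine additive_ext (F := fun Γ => types 0 (rename (upr f) Γ)) rfl rfl
    (by simp [rename_add, types_add]) (types_add 0) (fun i τ => ?_) Γ
  cases i <;> simp [rename_singleton, types_singleton, upr]

theorem drop_zero_rename_upr (f : ℕ → ℕ) (Γ : Ctx) :
    drop 0 (rename (upr f) Γ) = rename f (drop 0 Γ) := by
  refine additive_ext (F := fun Γ => drop 0 (rename (upr f) Γ)) (G := fun Γ => rename f (drop 0 Γ))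
    rfl rfl (by simp [rename_add, drop_add]) (by simp [rename_add, drop_add]) (fun i τ => ?_) Γ
  cases i <;> simp [rename_singleton, drop_singleton, upr]

theorem types_drop_zero (d : ℕ) (Γ : Ctx) : types d (drop 0 Γ) = types (d + 1) Γ := by
  refine additive_ext (F := fun Γ => types d (drop 0 Γ)) rfl rfl
    (by simp [types_add, drop_add]) (types_add _) (fun i τ => ?_) Γ
  cases i <;> simp [types_singleton, drop_singleton]

theorem drop_zero_drop_succ (d : ℕ) (Γ : Ctx) : drop 0 (drop (d + 1) Γ) = drop d (drop 0 Γ) := by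
  refine additive_ext (F := fun Γ => drop 0 (drop (d + 1) Γ)) (G := fun Γ => drop d (drop 0 Γ))
    rfl rfl (by simp [drop_add]) (by simp [drop_add]) (fun i τ => ?_) Γ
  rcases i with _ | i
  · simp [drop_singleton]
  · rcases lt_trichotomy i d with h | h | h
    · simp [drop_singleton, h]
    · simp [drop_singleton, h]
    · obtain ⟨j, rfl⟩ := Nat.exists_eq_succ_of_ne_zero (Nat.ne_of_gt (Nat.zero_lt_of_lt h))
      simp [drop_singleton, h.ne', Nat.not_lt.2 h.le]

theorem types_zero_drop_succ (d : ℕ) (Γ : Ctx) : types 0 (drop (d + 1) Γ) = types 0 Γ := by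
  refine additive_ext (F := fun Γ => types 0 (drop (d + 1) Γ)) rfl rfl
    (by simp [types_add, drop_add]) (types_add _) (fun i τ => ?_) Γ
  rcases i with _ | i
  · simp [drop_singleton, types_singleton]
  · rcases lt_trichotomy i d with h | h | h
    · simp [drop_singleton, types_singleton, h]
    · simp [drop_singleton, types_singleton, h]
    · simp [drop_singleton, types_singleton, h.ne', Nat.not_lt.2 h.le, Nat.ne_of_gt (Nat.zero_lt_of_lt h)]

theorem types_zero_rename_add_succ (d : ℕ) (Γ : Ctx) : types 0 (rename (· + (d + 1)) Γ) = 0 := by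
  refine additive_ext (F := fun Γ => types 0 (rename (· + (d + 1)) Γ)) (G := fun _ => 0) rfl rfl
    (by simp [types_add, rename_add]) (by simp) (fun i τ => ?_) Γ
  simp [rename_singleton, types_singleton]

theorem drop_zero_rename_add_succ (d : ℕ) (Γ : Ctx) :
    drop 0 (rename (· + (d + 1)) Γ) = rename (· + d) Γ := by
  refine additive_ext (F := fun Γ => drop 0 (rename (· + (d + 1)) Γ)) rfl rfl
    (by simp [drop_add, rename_add]) (rename_add _) (fun i τ => ?_) Γ
  simp [rename_singleton, drop_singleton]

theorem rename_id (Γ : Ctx) : rename id Γ = Γ := by simp [rename]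

end Ctx

theorem upr_id : upr id = id := by
  funext n; cases n <;> rfl

theorem upr_comp (f g : ℕ → ℕ) : upr (fun i => f (g i)) = fun i => upr f (upr g i) := by
  funext n; cases n <;> rfl

namespace DTerm

/-! ### Renaming and substitution in dCBN -/

theorem rename_id (M : DTerm) : M.rename id = M := by
  induction M with
  | var i => rfl
  | lam M ih => simp [rename, upr_id, ih]
  | app M N ihM ihN => simp [rename, ihM, ihN]
  | sub M N ihM ihN => simp [rename, upr_id, ihM, ihN]

theorem lift_zero (M : DTerm) : M.lift 0 = M := M.rename_id

theorem rename_rename (M : DTerm) (f g : ℕ → ℕ) :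
    (M.rename f).rename g = M.rename (fun i => g (f i)) := by
  induction M generalizing f g with
  | var i => rfl
  | lam M ih => simp [rename, upr_comp, ih]
  | app M N ihM ihN => simp [rename, ihM, ihN]
  | sub M N ihM ihN => simp [rename, upr_comp, ihM, ihN]

theorem lift_lift (M : DTerm) (j k : ℕ) : (M.lift j).lift k = M.lift (j + k) := by
  simp [lift, rename_rename, Nat.add_assoc]

/-- The substitution of `N` for the variable `d`, whose index disappears. -/
def single (d : ℕ) (N : DTerm) (i : ℕ) : DTerm :=
  if i < d then var i else if i = d then N.lift d else var (i - 1)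

theorem single_lt {d i : ℕ} (N : DTerm) (h : i < d) : single d N i = var i := by simp [single, h]

theorem single_self (d : ℕ) (N : DTerm) : single d N d = N.lift d := by simp [single]

theorem single_succ {d i : ℕ} (N : DTerm) (h : d ≤ i) : single d N (i + 1) = var i := by
  have h₁ : ¬ i + 1 < d := by omega
  have h₂ : i + 1 ≠ d := by omega
  simp [single, h₁, h₂]

/-- Single substitutions are stable under binders because the lift of `N` is tied to `d`. Inductions
on a substituted term therefore only have to generalize `d`. -/
theorem ups_single (d : ℕ) (N : DTerm) : ups (single d N) = single (d + 1) N := by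
  funext i
  rcases i with _ | i
  · simp [ups, single]
  · rcases lt_trichotomy i d with h | h | h
    · simp [ups, single, h, lift, rename]
    · simp [ups, single, h, lift_lift]
    · obtain ⟨j, rfl⟩ := Nat.exists_eq_succ_of_ne_zero (Nat.ne_of_gt (Nat.zero_lt_of_lt h))
      rw [ups, single_succ _ (Nat.le_of_lt_succ h), single_succ _ (Nat.succ_le_of_lt h)]
      rfl

theorem inst_eq (M N : DTerm) : M.inst N = M.psubst (single 0 N) := by
  unfold inst
  congr 1
  funext i
  cases i with
  | zero => rw [single_self, lift_zero]
  | succ i => rw [single_succ _ (Nat.zero_le i)]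

theorem step_beta (M N : DTerm) : Step (app (lam M) N) (sub M N) := by
  have h := Step.beta [] M N
  rwa [List.length_nil, lift_zero] at h

theorem Reduces.map {f : DTerm → DTerm} (hf : ∀ M M', Step M M' → Step (f M) (f M')) {M M' : DTerm}
    (h : Reduces M M') : Reduces (f M) (f M') :=
  Relation.ReflTransGen.lift (p := Step) f hf _ _ h

/-- A β-step in the empty list context, followed by execution of the explicit substitution it
creates. -/
theorem reduces_inst (M N : DTerm) : Reduces (app (lam M) N) (M.psubst (single 0 N)) := by
  rw [← inst_eq]
  exact (Relation.ReflTransGen.single (step_beta M N)).tail (Step.subst M N)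

end DTerm

namespace RTerm

/-! ### Renaming of resource terms -/

theorem rename_id (m : RTerm) : m.rename id = m := by
  induction m using RTerm.induction with
  | hvar i => rw [rename_var]; rfl
  | hlam m ih => rw [rename_lam, upr_id, ih]
  | happ m n ihm ihn => rw [rename_app, ihm, ihn]
  | hbag s ih => rw [rename_bag, Multiset.map_congr rfl ih, Multiset.map_id']
  | hder m ih => rw [rename_der, ih]
  | hsub m n ihm ihn => rw [rename_sub, upr_id, ihm, ihn]

theorem lift_zero (m : RTerm) : m.lift 0 = m := m.rename_id

theorem rename_rename (m : RTerm) (f g : ℕ → ℕ) :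
    (m.rename f).rename g = m.rename (fun i => g (f i)) := by
  induction m using RTerm.induction generalizing f g with
  | hvar i => simp only [rename_var]
  | hlam m ih => simp only [rename_lam, upr_comp, ih]
  | happ m n ihm ihn => simp only [rename_app, ihm, ihn]
  | hbag s ih =>
    simp only [rename_bag, Multiset.map_map, Function.comp_def]
    rw [Multiset.map_congr rfl (fun m hm => ih m hm f g)]
  | hder m ih => simp only [rename_der, ih]
  | hsub m n ihm ihn => simp only [rename_sub, upr_comp, ihm, ihn]

theorem lift_lift (m : RTerm) (j k : ℕ) : (m.lift j).lift k = m.lift (j + k) := by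
  simp [lift, rename_rename, Nat.add_assoc]

end RTerm

/-! ### The sized type system for dCBN -/

namespace DTerm

/-- `DTyped k Γ M (inl τ)`: the term `M` has type `τ` in the context `Γ`, by a derivation of size `k`;
`DTyped k Γ M (inr L)`: likewise for a family of derivations, one for each element of `L`. -/
inductive DTyped : ℕ → Ctx → DTerm → Ty ⊕ Multiset Ty → Prop
  | var (i : ℕ) (τ : Ty) : DTyped 0 {(i, τ)} (var i) (.inl τ)
  | lam {k : ℕ} {Γ : Ctx} {M : DTerm} {L : List Ty} {τ : Ty} : DTyped k Γ M (.inl τ) →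
      (L : Multiset Ty) = Γ.types 0 → DTyped (k + 1) (Γ.drop 0) (lam M) (.inl (.arr L τ))
  | app {k l : ℕ} {Γ Δ : Ctx} {M N : DTerm} {L : List Ty} {τ : Ty} :
      DTyped k Γ M (.inl (.arr L τ)) → DTyped l Δ N (.inr L) →
        DTyped (k + l + 1) (Γ + Δ) (app M N) (.inl τ)
  | sub {k l : ℕ} {Γ Δ : Ctx} {M N : DTerm} {τ : Ty} :
      DTyped k Γ M (.inl τ) → DTyped l Δ N (.inr (Γ.types 0)) →
        DTyped (k + l + 1) (Γ.drop 0 + Δ) (sub M N) (.inl τ)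
  | nil (M : DTerm) : DTyped 0 0 M (.inr 0)
  | cons {k l : ℕ} {Γ Δ : Ctx} {M : DTerm} {τ : Ty} {L : Multiset Ty} :
      DTyped k Γ M (.inl τ) → DTyped l Δ M (.inr L) → DTyped (k + l) (Γ + Δ) M (.inr (τ ::ₘ L))

theorem DTyped.rename {k : ℕ} {Γ : Ctx} {M : DTerm} {X : Ty ⊕ Multiset Ty} (h : DTyped k Γ M X)
    (f : ℕ → ℕ) : DTyped k (Γ.rename f) (M.rename f) X := by
  induction h generalizing f with
  | var i τ => exact .var _ _
  | lam _ hL ih =>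
    rw [← Ctx.drop_zero_rename_upr]
    exact .lam (ih (upr f)) (by rw [Ctx.types_zero_rename_upr, hL])
  | app _ _ ihM ihN =>
    rw [Ctx.rename_add]
    exact .app (ihM f) (ihN f)
  | @sub k l Γ Δ M N τ _ _ ihM ihN =>
    rw [Ctx.rename_add, ← Ctx.drop_zero_rename_upr]
    exact .sub (ihM (upr f)) (by rw [Ctx.types_zero_rename_upr]; exact ihN f)
  | nil M => exact .nil _
  | cons _ _ ihM ihN =>
    rw [Ctx.rename_add]
    exact .cons (ihM f) (ihN f)

/-! ### Splitting families of derivations, and the substitution lemma. -/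

theorem DTyped.nil_inv {k : ℕ} {Γ : Ctx} {M : DTerm} (h : DTyped k Γ M (.inr 0)) :
    k = 0 ∧ Γ = 0 := by
  generalize e : (Sum.inr 0 : Ty ⊕ Multiset Ty) = X at h
  cases h <;> simp at e
  · exact ⟨rfl, rfl⟩

/-- A family is built in some order, but its types form a multiset. If `τ` was not the last type
added, it is extracted from the rest by induction and the remaining derivations are regrouped. -/
theorem DTyped.cons_inv {k : ℕ} {Γ : Ctx} {M : DTerm} {τ : Ty} {L : Multiset Ty}
    (h : DTyped k Γ M (.inr (τ ::ₘ L))) : ∃ k₁ k₂ Γ₁ Γ₂, k = k₁ + k₂ ∧ Γ = Γ₁ + Γ₂ ∧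
      DTyped k₁ Γ₁ M (.inl τ) ∧ DTyped k₂ Γ₂ M (.inr L) := by
  generalize e : (Sum.inr (τ ::ₘ L) : Ty ⊕ Multiset Ty) = X at h
  induction h generalizing L with
  | nil M => exact absurd (Sum.inr.inj e) Multiset.cons_ne_zero
  | @cons k l Γ Δ M σ L' h₁ h₂ _ ih =>
    rcases Multiset.cons_eq_cons.1 (Sum.inr.inj e) with ⟨rfl, rfl⟩ | ⟨_, K, rfl, rfl⟩
    · exact ⟨k, l, Γ, Δ, rfl, rfl, h₁, h₂⟩
    · obtain ⟨k₁, k₂, Γ₁, Γ₂, rfl, rfl, h₃, h₄⟩ := ih rfl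
      exact ⟨k₁, k + k₂, Γ₁, Γ + Γ₂, by omega, add_left_comm _ _ _, h₃, .cons h₁ h₄⟩
  | _ => exact nomatch e

/-- Serves to share out the derivations of a substituted argument between the subterms that use it.
-/
theorem DTyped.add_inv {k : ℕ} {Γ : Ctx} {M : DTerm} {K L : Multiset Ty}
    (h : DTyped k Γ M (.inr (K + L))) : ∃ k₁ k₂ Γ₁ Γ₂, k = k₁ + k₂ ∧ Γ = Γ₁ + Γ₂ ∧
      DTyped k₁ Γ₁ M (.inr K) ∧ DTyped k₂ Γ₂ M (.inr L) := by
  induction K using Multiset.induction_on generalizing k Γ with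
  | empty => exact ⟨0, k, 0, Γ, (zero_add _).symm, (zero_add _).symm, .nil M, by simpa using h⟩
  | cons τ K ih =>
    rw [Multiset.cons_add] at h
    obtain ⟨k₁, k₂, Γ₁, Γ₂, rfl, rfl, h₁, h₂⟩ := h.cons_inv
    obtain ⟨k₃, k₄, Γ₃, Γ₄, rfl, rfl, h₃, h₄⟩ := ih h₂
    exact ⟨k₁ + k₃, k₄, Γ₁ + Γ₃, Γ₄, (add_assoc _ _ _).symm, (add_assoc _ _ _).symm,
      .cons h₁ h₃, h₄⟩

theorem DTyped.singleton_inv {k : ℕ} {Γ : Ctx} {M : DTerm} {τ : Ty}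
    (h : DTyped k Γ M (.inr {τ})) : DTyped k Γ M (.inl τ) := by
  obtain ⟨k₁, k₂, Γ₁, Γ₂, rfl, rfl, h₁, h₂⟩ := DTyped.cons_inv (L := 0) h
  obtain ⟨rfl, rfl⟩ := h₂.nil_inv
  simpa using h₁

/-- Substitution does not increase the size of derivations. -/
theorem DTyped.psubst_single {k l d : ℕ} {Γ Δ : Ctx} {M N : DTerm} {X : Ty ⊕ Multiset Ty}
    (h : DTyped k Γ M X) (hN : DTyped l Δ N (.inr (Γ.types d))) :
    ∃ j ≤ k + l, DTyped j (Γ.drop d + Δ.rename (· + d)) (M.psubst (single d N)) X := by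
  induction h generalizing d l Δ with
  | var i τ =>
    rw [Ctx.types_singleton] at hN
    rw [Ctx.drop_singleton, psubst]
    rcases lt_trichotomy i d with h | rfl | h
    · rw [if_neg h.ne] at hN
      obtain ⟨rfl, rfl⟩ := hN.nil_inv
      rw [if_pos h, single_lt _ h]
      exact ⟨0, le_rfl, by simpa using DTyped.var i τ⟩
    · rw [if_pos rfl] at hN
      simp only [lt_irrefl, if_false, if_true, zero_add, single_self]
      -- The axiom has size 0, so putting the unique derivation of `N` in its place gives exactly
      -- size `l`.
      exact ⟨l, le_rfl, hN.singleton_inv.rename _⟩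
    · rw [if_neg h.ne'] at hN
      obtain ⟨rfl, rfl⟩ := hN.nil_inv
      rw [if_neg (Nat.not_lt.2 h.le), if_neg h.ne']
      obtain ⟨j, rfl⟩ := Nat.exists_eq_succ_of_ne_zero (Nat.ne_of_gt (Nat.zero_lt_of_lt h))
      rw [single_succ _ (Nat.le_of_lt_succ h)]
      exact ⟨0, le_rfl, by simpa using DTyped.var j τ⟩
  | @lam k Γ M L τ h hL ih =>
    rw [Ctx.types_drop_zero] at hN
    obtain ⟨j, hj, h'⟩ := ih hN
    refine ⟨j + 1, by omega, ?_⟩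
    have := DTyped.lam (L := L) h'
      (by rw [hL, Ctx.types_add, Ctx.types_zero_drop_succ, Ctx.types_zero_rename_add_succ, add_zero])
    rw [Ctx.drop_add, Ctx.drop_zero_drop_succ, Ctx.drop_zero_rename_add_succ] at this
    rwa [psubst, ups_single]
  | app _ _ ihM ihN =>
    rw [Ctx.types_add] at hN
    obtain ⟨l₁, l₂, Δ₁, Δ₂, rfl, rfl, h₁, h₂⟩ := hN.add_inv
    obtain ⟨j₁, hj₁, h₁⟩ := ihM h₁
    obtain ⟨j₂, hj₂, h₂⟩ := ihN h₂
    refine ⟨j₁ + j₂ + 1, by omega, ?_⟩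
    rw [Ctx.drop_add, Ctx.rename_add, add_add_add_comm]
    exact .app h₁ h₂
  | sub _ _ ihM ihN =>
    rw [Ctx.types_add, Ctx.types_drop_zero] at hN
    obtain ⟨l₁, l₂, Δ₁, Δ₂, rfl, rfl, h₁, h₂⟩ := hN.add_inv
    obtain ⟨j₁, hj₁, h₁⟩ := ihM h₁
    obtain ⟨j₂, hj₂, h₂⟩ := ihN h₂
    refine ⟨j₁ + j₂ + 1, by omega, ?_⟩
    have := DTyped.sub h₁ (by
      rwa [Ctx.types_add, Ctx.types_zero_drop_succ, Ctx.types_zero_rename_add_succ, add_zero])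
    rw [Ctx.drop_add, Ctx.drop_zero_drop_succ, Ctx.drop_zero_rename_add_succ,
      add_add_add_comm, ← Ctx.drop_add, ← Ctx.rename_add] at this
    rwa [psubst, ups_single]
  | nil M =>
    obtain ⟨rfl, rfl⟩ := hN.nil_inv
    exact ⟨0, le_rfl, .nil _⟩
  | cons _ _ ihM ihN =>
    rw [Ctx.types_add] at hN
    obtain ⟨l₁, l₂, Δ₁, Δ₂, rfl, rfl, h₁, h₂⟩ := hN.add_inv
    obtain ⟨j₁, hj₁, h₁⟩ := ihM h₁
    obtain ⟨j₂, hj₂, h₂⟩ := ihN h₂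
    refine ⟨j₁ + j₂, by omega, ?_⟩
    rw [Ctx.drop_add, Ctx.rename_add, add_add_add_comm]
    exact .cons h₁ h₂

/-! ### Head normal forms -/

/-- `Neutral y n M`: the term `M` is the variable `y` applied to `n` arguments. -/
inductive Neutral : ℕ → ℕ → DTerm → Prop
  | var (y : ℕ) : Neutral y 0 (var y)
  | app {y n : ℕ} {M : DTerm} (N : DTerm) : Neutral y n M → Neutral y (n + 1) (app M N)

/-- `Hnf j y n M`: the term `M` consists of `j` abstractions over a variable `y` applied to `n`
arguments. -/
inductive Hnf : ℕ → ℕ → ℕ → DTerm → Prop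
  | neutral {y n : ℕ} {M : DTerm} : Neutral y n M → Hnf 0 y n M
  | lam {j y n : ℕ} {M : DTerm} : Hnf j y n M → Hnf (j + 1) y n (lam M)

/-- A typable term is a head normal form or has a (head) reduct with a smaller derivation. -/
theorem DTyped.progress {M : DTerm} : ∀ {k : ℕ} {Γ : Ctx} {τ : Ty}, DTyped k Γ M (.inl τ) →
    (∃ j y n, Hnf j y n M) ∨ ∃ M' k', k' < k ∧ Step M M' ∧ DTyped k' Γ M' (.inl τ) := by
  induction M with
  | var i => exact fun _ => .inl ⟨0, i, 0, .neutral (.var i)⟩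
  | lam M ih =>
    intro k Γ τ h
    cases h with
    | lam h hL =>
      rcases ih h with ⟨j, y, n, hM⟩ | ⟨M', k', hk, hs, h'⟩
      · exact .inl ⟨_, _, _, hM.lam⟩
      · exact .inr ⟨_, k' + 1, by omega, hs.lam, .lam h' hL⟩
  | app M N ih _ =>
    intro k Γ τ h
    cases h with
    | @app k l Γ Δ _ _ L _ h hN =>
      rcases ih h with ⟨j, y, n, hM⟩ | ⟨M', k', hk, hs, h'⟩
      · cases hM with
        | neutral hM => exact .inl ⟨_, _, _, .neutral (.app N hM)⟩
        | lam hM =>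
          cases h with
          | @lam k Γ M _ _ h hL =>
            -- The redex has size `(k + 1) + l + 1`; firing it saves the abstraction. The empty list
            -- context suffices, because an explicit substitution around the function would have
            -- been fired before.
            exact .inr ⟨_, k + l + 1, by omega, step_beta _ _, .sub h (hL ▸ hN)⟩
      · exact .inr ⟨_, k' + l + 1, by omega, .appL N hs, .app h' hN⟩
  | sub M N _ _ =>
    intro k Γ τ h
    cases h with
    | @sub k l Γ Δ _ _ _ h hN =>
      -- Here `j ≤ k + l`, so the unit counted by the `sub` rule is lost.
      obtain ⟨j, hj, h'⟩ := h.psubst_single hN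
      refine .inr ⟨_, j, by omega, .subst M N, ?_⟩
      rw [inst_eq]
      have e : Δ.rename (· + 0) = Δ := Δ.rename_id
      rwa [e] at h'

/-- The derivation size is a termination measure for the steps provided by `progress`. -/
theorem DTyped.exists_hnf {k : ℕ} {Γ : Ctx} {M : DTerm} {τ : Ty} (h : DTyped k Γ M (.inl τ)) :
    ∃ H j y n, Reduces M H ∧ Hnf j y n H := by
  induction k using Nat.strong_induction_on generalizing M with
  | _ k ih =>
    rcases h.progress with ⟨j, y, n, hM⟩ | ⟨M', k', hk, hs, h'⟩
    · exact ⟨M, j, y, n, .refl, hM⟩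
    · obtain ⟨H, j, y, n, hr, hH⟩ := ih k' hk h'
      exact ⟨H, j, y, n, .head hs hr, hH⟩

/-- If `T⟨M⟩` is typable, then so is `M`. -/
theorem DTyped.of_fill {M : DTerm} (T : TestCtx) {k : ℕ} {Γ : Ctx} {τ : Ty}
    (h : DTyped k Γ (T.fill M) (.inl τ)) : ∃ k Γ τ, DTyped k Γ M (.inl τ) := by
  induction T generalizing k Γ τ with
  | hole => exact ⟨k, Γ, τ, h⟩
  | app T N ih => cases h with | app h _ => exact ih h
  | lamApp T N ih => cases h with | app h _ => cases h with | lam h _ => exact ih h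

/-! ### Head normal forms are meaningful -/

/-- Composition of testing contexts. -/
def TestCtx.comp : TestCtx → TestCtx → TestCtx
  | .hole, U => U
  | .app T N, U => .app (T.comp U) N
  | .lamApp T N, U => .lamApp (T.comp U) N

theorem TestCtx.fill_comp (T U : TestCtx) (M : DTerm) : (T.comp U).fill M = T.fill (U.fill M) := by
  induction T with
  | hole => rfl
  | app T N ih => simp [comp, fill, ih]
  | lamApp T N ih => simp [comp, fill, ih]

theorem TestCtx.fill_step (T : TestCtx) {M M' : DTerm} (h : Step M M') :
    Step (T.fill M) (T.fill M') := by
  induction T with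
  | hole => exact h
  | app T N ih => exact .appL N ih
  | lamApp T N ih => exact .appL N ih.lam

theorem Meaningful.of_reduces {M M' : DTerm} (h : Reduces M M') (h' : Meaningful M') :
    Meaningful M := by
  obtain ⟨T, hT⟩ := h'
  exact ⟨T, (h.map (fun _ _ => T.fill_step)).trans hT⟩

theorem Meaningful.of_fill {M : DTerm} (U : TestCtx) (h : Meaningful (U.fill M)) :
    Meaningful M := by
  obtain ⟨T, hT⟩ := h
  exact ⟨T.comp U, by rwa [TestCtx.fill_comp]⟩

/-- `const n` is the term `λx₁ … λxₙ λx x`. -/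
def const : ℕ → DTerm
  | 0 => lam (var 0)
  | n + 1 => lam (const n)

theorem const_rename (n : ℕ) (f : ℕ → ℕ) : (const n).rename f = const n := by
  induction n generalizing f with
  | zero => rfl
  | succ n ih => simp [const, rename, ih]

theorem const_psubst_single (n d : ℕ) (N : DTerm) : (const n).psubst (single d N) = const n := by
  induction n generalizing d with
  | zero => rfl
  | succ n ih => simp [const, psubst, ups_single, ih]

/-- Each leading abstraction discards its argument, so any argument, here a variable, removes it. -/
theorem const_meaningful (n : ℕ) : Meaningful (const n) := by
  induction n with
  | zero => exact ⟨.hole, .refl⟩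
  | succ n ih =>
    refine Meaningful.of_fill (.app .hole (var 0)) (Meaningful.of_reduces (reduces_inst _ _) ?_)
    rwa [const_psubst_single]

theorem Neutral.psubst_lt {y n d : ℕ} {M : DTerm} (h : Neutral y n M) (hy : y < d) (N : DTerm) :
    Neutral y n (M.psubst (single d N)) := by
  induction h with
  | var => rw [psubst, single_lt _ hy]; exact .var y
  | app N _ ih => exact .app _ ih

theorem Neutral.psubst_ge {y n d : ℕ} {M : DTerm} (h : Neutral (y + 1) n M) (hy : d ≤ y)
    (N : DTerm) : Neutral y n (M.psubst (single d N)) := by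
  induction h with
  | var => rw [psubst, single_succ _ hy]; exact .var y
  | app N _ ih => exact .app _ ih

/-- Each of the `n` arguments erases one abstraction of the substituted head. The surplus `k` makes
the induction go through: setting the last argument aside leaves one more abstraction for it to
erase. -/
theorem Neutral.psubst_self {d n : ℕ} {M : DTerm} (h : Neutral d n M) (k : ℕ) :
    Reduces (M.psubst (single d (const (n + k)))) (const k) := by
  induction h generalizing k with
  | var => rw [psubst, single_self, lift, const_rename, zero_add]; exact .refl
  | @app n M N _ ih =>
    have h := ih (k + 1)
    rw [← Nat.add_assoc, Nat.add_right_comm] at h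
    refine (h.map (fun _ _ => Step.appL _)).trans ?_
    have h' := reduces_inst (const k) (N.psubst (single d (const (n + 1 + k))))
    rwa [const_psubst_single] at h'

theorem Hnf.psubst_lt {j y n d : ℕ} {M : DTerm} (h : Hnf j y n M) (hy : y < j + d) (N : DTerm) :
    Hnf j y n (M.psubst (single d N)) := by
  induction h generalizing d with
  | neutral h => exact .neutral (h.psubst_lt (by omega) N)
  | lam _ ih => rw [psubst, ups_single]; exact .lam (ih (by omega))

theorem Hnf.psubst_ge {j y n d : ℕ} {M : DTerm} (h : Hnf j (y + 1) n M) (hy : j + d ≤ y)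
    (N : DTerm) : Hnf j y n (M.psubst (single d N)) := by
  generalize e : y + 1 = z at h
  induction h generalizing d with
  | neutral h => subst e; exact .neutral (h.psubst_ge (by omega) N)
  | lam _ ih => rw [psubst, ups_single]; exact .lam (ih (by omega) e)

theorem Hnf.psubst_self {j y n d : ℕ} {M : DTerm} (h : Hnf j y n M) (hy : y = j + d) :
    Reduces (M.psubst (single d (const n))) (const j) := by
  induction h generalizing d with
  | @neutral y n M h =>
    obtain rfl : y = d := by omega
    exact h.psubst_self 0
  | lam _ ih =>
    rw [psubst, ups_single]
    exact (ih (by omega)).map (fun _ _ => Step.lam)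

/-- A head normal form in which the outermost variable is replaced by `const n`. -/
theorem Hnf.meaningful_psubst {j y n : ℕ} {M : DTerm} (h : Hnf j y n M)
    (ih : ∀ z M', Hnf j z n M' → Meaningful M') :
    Meaningful (M.psubst (single 0 (const n))) := by
  -- Under the `j` abstractions, the index `0` of `M` reads `j`: the head is bound inside `M`, is
  -- the substituted variable, or is another free variable.
  rcases lt_trichotomy y j with hy | rfl | hy
  · exact ih y _ (h.psubst_lt (by omega) _)
  · exact Meaningful.of_reduces (h.psubst_self rfl) (const_meaningful _)
  · obtain ⟨z, rfl⟩ := Nat.exists_eq_succ_of_ne_zero (Nat.ne_of_gt (Nat.zero_lt_of_lt hy))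
    exact ih z _ (h.psubst_ge (by omega) _)

/-- The test supplies `const n` for every leading abstraction and then for free variables until the
head is reached. Substituting for a variable other than the head keeps both the head normal form and
`n`, so the same `const n` works throughout. -/
theorem Hnf.meaningful {j y n : ℕ} {M : DTerm} (h : Hnf j y n M) : Meaningful M := by
  induction j generalizing y M with
  | zero =>
    -- Without leading abstractions the head is free. Each `lamApp` captures the index `0` and
    -- lowers the head's index, until the head itself is captured.
    induction y generalizing M with
    | zero =>
      refine Meaningful.of_fill (.lamApp .hole (const n))
        (Meaningful.of_reduces (reduces_inst _ _) (Meaningful.of_reduces (h.psubst_self rfl) ?_))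
      exact const_meaningful 0
    | succ y ih =>
      exact Meaningful.of_fill (.lamApp .hole (const n))
        (Meaningful.of_reduces (reduces_inst _ _) (ih (h.psubst_ge (by omega) _)))
  | succ j ih =>
    cases h with
    | lam h =>
      refine Meaningful.of_fill (.app .hole (const n))
        (Meaningful.of_reduces (reduces_inst _ _) ?_)
      exact h.meaningful_psubst (fun _ _ => ih)

end DTerm

/-! ### The type system for resource terms -/

namespace RTerm

/-- `Typed Γ m (inl τ)`: the resource term `m` has type `τ` in the context `Γ`;
`Typed Γ m (inr L)`: the resource term `m` is a bag, and the elements of `L` are the types of its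
elements. -/
inductive Typed : Ctx → RTerm → Ty ⊕ Multiset Ty → Prop
  | var (i : ℕ) (τ : Ty) : Typed {(i, τ)} (var i) (.inl τ)
  | lam {Γ : Ctx} {m : RTerm} {L : List Ty} {τ : Ty} : Typed Γ m (.inl τ) →
      (L : Multiset Ty) = Γ.types 0 → Typed (Γ.drop 0) (lam m) (.inl (.arr L τ))
  | app {Γ Δ : Ctx} {m n : RTerm} {L : List Ty} {τ : Ty} :
      Typed Γ m (.inl (.arr L τ)) → Typed Δ n (.inr L) → Typed (Γ + Δ) (app m n) (.inl τ)
  | sub {Γ Δ : Ctx} {m n : RTerm} {τ : Ty} :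
      Typed Γ m (.inl τ) → Typed Δ n (.inr (Γ.types 0)) → Typed (Γ.drop 0 + Δ) (sub m n) (.inl τ)
  | nil : Typed 0 (bag 0) (.inr 0)
  | cons {Γ Δ : Ctx} {m : RTerm} {s : Multiset RTerm} {τ : Ty} {L : Multiset Ty} :
      Typed Γ m (.inl τ) → Typed Δ (bag s) (.inr L) →
        Typed (Γ + Δ) (bag (m ::ₘ s)) (.inr (τ ::ₘ L))

/-- Constructors of `RTerm` are definitions over a quotient fixed point, so the inversions here
first abstract the term and then discriminate through injectivity of `mk`. -/
theorem Typed.var_inv {Γ : Ctx} {i : ℕ} {X : Ty ⊕ Multiset Ty} (h : Typed Γ (RTerm.var i) X) :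
    ∃ τ, Γ = {(i, τ)} ∧ X = .inl τ := by
  generalize e : RTerm.var i = t at h
  cases h <;> cases mk_injective e
  exact ⟨_, rfl, rfl⟩

theorem Typed.lam_inv {Γ : Ctx} {m : RTerm} {X : Ty ⊕ Multiset Ty} (h : Typed Γ (RTerm.lam m) X) :
    ∃ (Γ' : Ctx) (L : List Ty) (τ : Ty), Γ = Γ'.drop 0 ∧ X = .inl (.arr L τ) ∧
      (L : Multiset Ty) = Γ'.types 0 ∧ Typed Γ' m (.inl τ) := by
  generalize e : RTerm.lam m = t at h
  cases h <;> cases mk_injective e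
  exact ⟨_, _, _, rfl, rfl, ‹_›, ‹_›⟩

theorem Typed.app_inv {Γ : Ctx} {m n : RTerm} {X : Ty ⊕ Multiset Ty}
    (h : Typed Γ (RTerm.app m n) X) : ∃ (Γ₁ Γ₂ : Ctx) (L : List Ty) (τ : Ty), Γ = Γ₁ + Γ₂ ∧
      X = .inl τ ∧ Typed Γ₁ m (.inl (.arr L τ)) ∧ Typed Γ₂ n (.inr L) := by
  generalize e : RTerm.app m n = t at h
  cases h <;> cases mk_injective e
  exact ⟨_, _, _, _, rfl, rfl, ‹_›, ‹_›⟩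

theorem Typed.sub_inv {Γ : Ctx} {m n : RTerm} {X : Ty ⊕ Multiset Ty}
    (h : Typed Γ (RTerm.sub m n) X) : ∃ (Γ₁ Γ₂ : Ctx) (τ : Ty), Γ = Γ₁.drop 0 + Γ₂ ∧
      X = .inl τ ∧ Typed Γ₁ m (.inl τ) ∧ Typed Γ₂ n (.inr (Γ₁.types 0)) := by
  generalize e : RTerm.sub m n = t at h
  cases h <;> cases mk_injective e
  exact ⟨_, _, _, rfl, rfl, ‹_›, ‹_›⟩

theorem Typed.not_der {Γ : Ctx} {m : RTerm} {X : Ty ⊕ Multiset Ty} :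
    ¬ Typed Γ (RTerm.der m) X := by
  intro h
  generalize e : RTerm.der m = t at h
  cases h <;> cases mk_injective e

theorem Typed.nil_inv {Γ : Ctx} {X : Ty ⊕ Multiset Ty} (h : Typed Γ (bag 0) X) :
    Γ = 0 ∧ X = .inr 0 := by
  generalize e : bag 0 = t at h
  cases h with
  | nil => exact ⟨rfl, rfl⟩
  | cons => exact absurd (RShape.bag.inj (mk_injective e)).symm Multiset.cons_ne_zero
  | _ => cases mk_injective e

theorem Typed.cons_inv {Γ : Ctx} {m : RTerm} {s : Multiset RTerm} {X : Ty ⊕ Multiset Ty}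
    (h : Typed Γ (bag (m ::ₘ s)) X) : ∃ (Γ₁ Γ₂ : Ctx) (τ : Ty) (L : Multiset Ty), Γ = Γ₁ + Γ₂ ∧
      X = .inr (τ ::ₘ L) ∧ Typed Γ₁ m (.inl τ) ∧ Typed Γ₂ (bag s) (.inr L) := by
  generalize e : bag (m ::ₘ s) = t at h
  induction h generalizing s with
  | nil => exact absurd (RShape.bag.inj (mk_injective e)) Multiset.cons_ne_zero
  | @cons Γ Δ n t σ L h₁ h₂ _ ih =>
    rcases Multiset.cons_eq_cons.1 (RShape.bag.inj (mk_injective e)) with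
      ⟨rfl, rfl⟩ | ⟨_, u, rfl, rfl⟩
    · exact ⟨Γ, Δ, σ, L, rfl, rfl, h₁, h₂⟩
    · obtain ⟨Γ₁, Γ₂, τ, K, rfl, hK, h₃, h₄⟩ := ih rfl
      cases hK
      exact ⟨Γ₁, Γ + Γ₂, τ, σ ::ₘ K, add_left_comm _ _ _, by rw [Multiset.cons_swap], h₃,
        .cons h₁ h₄⟩
  | _ => cases mk_injective e

/-! ### Call-by-name resource terms -/

/-- The resource terms of the shape of approximants (for the index `false`), and bags of such terms
(for the index `true`). -/
inductive CBN : Bool → RTerm → Prop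
  | var (i : ℕ) : CBN false (var i)
  | lam {m : RTerm} : CBN false m → CBN false (lam m)
  | app {m n : RTerm} : CBN false m → CBN true n → CBN false (app m n)
  | sub {m n : RTerm} : CBN false m → CBN true n → CBN false (sub m n)
  | bag {s : Multiset RTerm} : (∀ m ∈ s, CBN false m) → CBN true (bag s)

theorem CBN.lam_inv {b : Bool} {m : RTerm} (h : CBN b (RTerm.lam m)) : b = false ∧ CBN false m := by
  generalize e : RTerm.lam m = t at h
  cases h <;> cases mk_injective e
  exact ⟨rfl, ‹_›⟩

theorem CBN.app_inv {b : Bool} {m n : RTerm} (h : CBN b (RTerm.app m n)) :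
    b = false ∧ CBN false m ∧ CBN true n := by
  generalize e : RTerm.app m n = t at h
  cases h <;> cases mk_injective e
  exact ⟨rfl, ‹_›, ‹_›⟩

theorem CBN.sub_inv {b : Bool} {m n : RTerm} (h : CBN b (RTerm.sub m n)) :
    b = false ∧ CBN false m ∧ CBN true n := by
  generalize e : RTerm.sub m n = t at h
  cases h <;> cases mk_injective e
  exact ⟨rfl, ‹_›, ‹_›⟩

theorem CBN.bag_inv {b : Bool} {s : Multiset RTerm} (h : CBN b (RTerm.bag s)) :
    b = true ∧ ∀ m ∈ s, CBN false m := by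
  generalize e : RTerm.bag s = t at h
  cases h <;> cases mk_injective e
  exact ⟨rfl, ‹_›⟩

theorem CBN.not_der {b : Bool} {m : RTerm} : ¬ CBN b (RTerm.der m) := by
  intro h
  generalize e : RTerm.der m = t at h
  cases h <;> cases mk_injective e

theorem CBN.rename {b : Bool} {m : RTerm} (h : CBN b m) (f : ℕ → ℕ) : CBN b (m.rename f) := by
  induction h generalizing f with
  | var i => rw [rename_var]; exact .var _
  | lam _ ih => rw [rename_lam]; exact .lam (ih _)
  | app _ _ ihm ihn => rw [rename_app]; exact .app (ihm _) (ihn _)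
  | sub _ _ ihm ihn => rw [rename_sub]; exact .sub (ihm _) (ihn _)
  | bag _ ih =>
    rw [rename_bag]
    refine .bag (fun m hm => ?_)
    obtain ⟨n, hn, rfl⟩ := Multiset.mem_map.1 hm
    exact ih n hn f

theorem Approx.cbn {m : RTerm} {M : DTerm} (h : Approx m M) : CBN false m := by
  induction h with
  | var i => exact .var i
  | lam _ ih => exact .lam ih
  | app _ _ ihm ihn => exact .app ihm (.bag ihn)
  | sub _ _ ihm ihn => exact .sub ihm (.bag ihn)

theorem LinSubst.cbn {d : ℕ} {ps : Multiset RTerm} {m r : RTerm} (hs : LinSubst d ps m r)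
    (hps : ∀ p ∈ ps, CBN false p) {b : Bool} (h : CBN b m) : CBN b r := by
  induction hs generalizing b with
  | var_eq d p =>
    generalize e : RTerm.var d = t at h
    cases h <;> cases mk_injective e
    exact (hps p (Multiset.mem_singleton_self p)).rename _
  | var_lt => exact h
  | var_gt =>
    generalize e : RTerm.var _ = t at h
    cases h <;> cases mk_injective e
    exact .var _
  | lam _ ih =>
    obtain ⟨rfl, hm⟩ := h.lam_inv
    exact .lam (ih hps hm)
  | app _ _ ihm ihn =>
    obtain ⟨rfl, hm, hn⟩ := h.app_inv
    exact .app (ihm (fun p hp => hps p (Multiset.mem_add.2 (.inl hp))) hm)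
      (ihn (fun p hp => hps p (Multiset.mem_add.2 (.inr hp))) hn)
  | bag_nil => exact h
  | bag_cons _ _ ihm ihn =>
    obtain ⟨rfl, hs⟩ := h.bag_inv
    have hm := ihm (fun p hp => hps p (Multiset.mem_add.2 (.inl hp)))
      (hs _ (Multiset.mem_cons_self _ _))
    have hn := ihn (fun p hp => hps p (Multiset.mem_add.2 (.inr hp)))
      (.bag (fun n hn => hs n (Multiset.mem_cons_of_mem hn)))
    refine .bag (fun n hn' => ?_)
    rcases Multiset.mem_cons.1 hn' with rfl | hn'
    · exact hm
    · exact hn.bag_inv.2 n hn'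
  | der _ _ => exact absurd h CBN.not_der
  | sub _ _ ihm ihn =>
    obtain ⟨rfl, hm, hn⟩ := h.sub_inv
    exact .sub (ihm (fun p hp => hps p (Multiset.mem_add.2 (.inl hp))) hm)
      (ihn (fun p hp => hps p (Multiset.mem_add.2 (.inr hp))) hn)

/-! ### Typings of bags, and pulling typings back along renaming and linear substitution. -/

/-- Only bags receive a multiset of types. This matters in `LinSubst.typed`, where the term
replacing a variable must have a single type. -/
theorem Typed.of_cbn {Γ : Ctx} {m : RTerm} {X : Ty ⊕ Multiset Ty} (h : Typed Γ m X)
    (hm : CBN false m) : ∃ τ, X = .inl τ := by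
  cases h with
  | nil => exact nomatch hm.bag_inv.1
  | cons => exact nomatch hm.bag_inv.1
  | _ => exact ⟨_, rfl⟩

theorem Typed.bag_singleton {Γ : Ctx} {m : RTerm} {τ : Ty} (h : Typed Γ m (.inl τ)) :
    Typed Γ (bag {m}) (.inr {τ}) := by
  have := h.cons .nil
  rwa [add_zero] at this

theorem Typed.bag_add {Γ Δ : Ctx} {s t : Multiset RTerm} {K L : Multiset Ty}
    (hs : Typed Γ (bag s) (.inr K)) (ht : Typed Δ (bag t) (.inr L)) :
    Typed (Γ + Δ) (bag (s + t)) (.inr (K + L)) := by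
  induction s using Multiset.induction_on generalizing Γ K with
  | empty =>
    obtain ⟨rfl, h⟩ := hs.nil_inv
    cases h
    simpa using ht
  | cons m s ih =>
    obtain ⟨Γ₁, Γ₂, τ, K', rfl, h, h₁, h₂⟩ := hs.cons_inv
    cases h
    rw [Multiset.cons_add, Multiset.cons_add, add_assoc]
    exact .cons h₁ (ih h₂)

/-- Contexts record typed occurrences, so they are pulled back occurrence by occurrence; injectivity
of `f` plays no role. -/
theorem Typed.rename_inv {Γ : Ctx} {m : RTerm} {f : ℕ → ℕ} {X : Ty ⊕ Multiset Ty}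
    (h : Typed Γ (m.rename f) X) : ∃ Δ : Ctx, Γ = Δ.rename f ∧ Typed Δ m X := by
  induction m using RTerm.induction generalizing Γ f X with
  | hvar i =>
    rw [rename_var] at h
    obtain ⟨τ, rfl, rfl⟩ := h.var_inv
    exact ⟨_, (Ctx.rename_singleton f i τ).symm, .var i τ⟩
  | hlam m ih =>
    rw [rename_lam] at h
    obtain ⟨Γ', L, τ, rfl, rfl, hL, h⟩ := h.lam_inv
    obtain ⟨Δ, rfl, h'⟩ := ih h
    exact ⟨_, Ctx.drop_zero_rename_upr f Δ, .lam h' (by rw [hL, Ctx.types_zero_rename_upr])⟩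
  | happ m n ihm ihn =>
    rw [rename_app] at h
    obtain ⟨Γ₁, Γ₂, L, τ, rfl, rfl, h₁, h₂⟩ := h.app_inv
    obtain ⟨Δ₁, rfl, h₁'⟩ := ihm h₁
    obtain ⟨Δ₂, rfl, h₂'⟩ := ihn h₂
    exact ⟨_, (Ctx.rename_add f Δ₁ Δ₂).symm, .app h₁' h₂'⟩
  | hbag s ih =>
    rw [rename_bag] at h
    induction s using Multiset.induction_on generalizing Γ X with
    | empty =>
      obtain ⟨rfl, rfl⟩ := h.nil_inv
      exact ⟨0, rfl, .nil⟩
    | cons m s ihs =>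
      rw [Multiset.map_cons] at h
      obtain ⟨Γ₁, Γ₂, τ, L, rfl, rfl, h₁, h₂⟩ := h.cons_inv
      obtain ⟨Δ₁, rfl, h₁'⟩ := ih m (Multiset.mem_cons_self m s) h₁
      obtain ⟨Δ₂, rfl, h₂'⟩ := ihs (fun n hn => ih n (Multiset.mem_cons_of_mem hn)) h₂
      exact ⟨_, (Ctx.rename_add f Δ₁ Δ₂).symm, .cons h₁' h₂'⟩
  | hder m _ =>
    rw [rename_der] at h
    exact absurd h Typed.not_der
  | hsub m n ihm ihn =>
    rw [rename_sub] at h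
    obtain ⟨Γ₁, Γ₂, τ, rfl, rfl, h₁, h₂⟩ := h.sub_inv
    obtain ⟨Δ₁, rfl, h₁'⟩ := ihm h₁
    obtain ⟨Δ₂, rfl, h₂'⟩ := ihn h₂
    refine ⟨Δ₁.drop 0 + Δ₂, by rw [Ctx.rename_add, Ctx.drop_zero_rename_upr], .sub h₁' ?_⟩
    rwa [Ctx.types_zero_rename_upr] at h₂'

/-- The typing of the result of a linear substitution comes from typings of its ingredients. -/
theorem LinSubst.typed {d : ℕ} {ps : Multiset RTerm} {m r : RTerm} (hs : LinSubst d ps m r)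
    (hps : ∀ p ∈ ps, CBN false p) {Γ : Ctx} {X : Ty ⊕ Multiset Ty} (h : Typed Γ r X) : ∃ Γ₀ Δ : Ctx,
      Γ = Γ₀.drop d + Δ.rename (· + d) ∧ Typed Γ₀ m X ∧ Typed Δ (bag ps) (.inr (Γ₀.types d)) := by
  induction hs generalizing Γ X with
  | var_eq d p =>
    obtain ⟨Δ, rfl, h'⟩ := h.rename_inv
    obtain ⟨τ, rfl⟩ := h'.of_cbn (hps p (Multiset.mem_singleton_self p))
    -- The occurrence of `d` is given whatever type its replacement has.
    exact ⟨{(d, τ)}, Δ, by simp [Ctx.drop_singleton], .var d τ, by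
      simpa [Ctx.types_singleton] using h'.bag_singleton⟩
  | @var_lt d i hi =>
    obtain ⟨τ, rfl, rfl⟩ := h.var_inv
    exact ⟨{(i, τ)}, 0, by simp [Ctx.drop_singleton, hi], .var i τ, by
      simpa [Ctx.types_singleton, hi.ne] using Typed.nil⟩
  | @var_gt d i hi =>
    obtain ⟨τ, rfl, rfl⟩ := h.var_inv
    have h₁ : ¬ i + 1 < d := by omega
    have h₂ : i + 1 ≠ d := by omega
    exact ⟨{(i + 1, τ)}, 0, by simp [Ctx.drop_singleton, h₁, h₂], .var _ τ, by
      simpa [Ctx.types_singleton, h₂] using Typed.nil⟩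
  | lam _ ih =>
    obtain ⟨Γ', L, τ, rfl, rfl, hL, h⟩ := h.lam_inv
    obtain ⟨Γ₀, Δ, rfl, h₁, h₂⟩ := ih hps h
    rw [Ctx.types_add, Ctx.types_zero_drop_succ, Ctx.types_zero_rename_add_succ, add_zero] at hL
    refine ⟨Γ₀.drop 0, Δ, ?_, .lam h₁ hL, by rwa [Ctx.types_drop_zero]⟩
    rw [Ctx.drop_add, Ctx.drop_zero_drop_succ, Ctx.drop_zero_rename_add_succ]
  | app _ _ ihm ihn =>
    obtain ⟨Γ₁, Γ₂, L, τ, rfl, rfl, h₁, h₂⟩ := h.app_inv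
    obtain ⟨Γ₁, Δ₁, rfl, h₁, h₁'⟩ := ihm (fun p hp => hps p (Multiset.mem_add.2 (.inl hp))) h₁
    obtain ⟨Γ₂, Δ₂, rfl, h₂, h₂'⟩ := ihn (fun p hp => hps p (Multiset.mem_add.2 (.inr hp))) h₂
    refine ⟨Γ₁ + Γ₂, Δ₁ + Δ₂, ?_, .app h₁ h₂, by rw [Ctx.types_add]; exact h₁'.bag_add h₂'⟩
    rw [Ctx.drop_add, Ctx.rename_add, add_add_add_comm]
  | bag_nil d =>
    obtain ⟨rfl, rfl⟩ := h.nil_inv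
    exact ⟨0, 0, rfl, .nil, .nil⟩
  | bag_cons _ _ ihm ihn =>
    obtain ⟨Γ₁, Γ₂, τ, L, rfl, rfl, h₁, h₂⟩ := h.cons_inv
    obtain ⟨Γ₁, Δ₁, rfl, h₁, h₁'⟩ := ihm (fun p hp => hps p (Multiset.mem_add.2 (.inl hp))) h₁
    obtain ⟨Γ₂, Δ₂, rfl, h₂, h₂'⟩ := ihn (fun p hp => hps p (Multiset.mem_add.2 (.inr hp))) h₂
    refine ⟨Γ₁ + Γ₂, Δ₁ + Δ₂, ?_, .cons h₁ h₂, by rw [Ctx.types_add]; exact h₁'.bag_add h₂'⟩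
    rw [Ctx.drop_add, Ctx.rename_add, add_add_add_comm]
  | der _ _ => exact absurd h Typed.not_der
  | sub _ _ ihm ihn =>
    obtain ⟨Γ₁, Γ₂, τ, rfl, rfl, h₁, h₂⟩ := h.sub_inv
    obtain ⟨Γ₁, Δ₁, rfl, h₁, h₁'⟩ := ihm (fun p hp => hps p (Multiset.mem_add.2 (.inl hp))) h₁
    obtain ⟨Γ₂, Δ₂, rfl, h₂, h₂'⟩ := ihn (fun p hp => hps p (Multiset.mem_add.2 (.inr hp))) h₂
    rw [Ctx.types_add, Ctx.types_zero_drop_succ, Ctx.types_zero_rename_add_succ, add_zero] at h₂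
    refine ⟨Γ₁.drop 0 + Γ₂, Δ₁ + Δ₂, ?_, .sub h₁ h₂, ?_⟩
    · rw [Ctx.drop_add, Ctx.drop_add, Ctx.drop_zero_drop_succ, Ctx.drop_zero_rename_add_succ,
        Ctx.rename_add, add_add_add_comm]
    · rw [Ctx.types_add, Ctx.types_drop_zero]
      exact h₁'.bag_add h₂'

/-! ### Subject expansion -/

theorem cbn_beta {l : List RTerm} {m n : RTerm} (h : CBN false (app (plug l (lam m)) n)) :
    CBN false (plug l (sub m (n.lift l.length))) := by
  induction l generalizing n with
  | nil =>
    obtain ⟨_, hm, hn⟩ := h.app_inv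
    rw [List.length_nil, lift_zero]
    exact .sub hm.lam_inv.2 hn
  | cons a l ih =>
    obtain ⟨_, hm, hn⟩ := h.app_inv
    obtain ⟨_, hm, ha⟩ := hm.sub_inv
    have := ih (.app hm (hn.rename (· + 1)))
    rw [← lift, lift_lift, Nat.add_comm] at this
    exact .sub this ha

/-- The list context is peeled from outside. The lifted argument does not use the variable bound by
the outermost substitution, so all types required of `a` come from the function part. -/
theorem typed_beta {l : List RTerm} {m n : RTerm} {Γ : Ctx} {X : Ty ⊕ Multiset Ty}
    (h : Typed Γ (plug l (sub m (n.lift l.length))) X) : Typed Γ (app (plug l (lam m)) n) X := by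
  induction l generalizing n Γ X with
  | nil =>
    rw [List.length_nil, lift_zero] at h
    obtain ⟨Γ₁, Γ₂, τ, rfl, rfl, hm, hn⟩ := h.sub_inv
    -- Arrows store lists; the typing rules accept any enumeration of the multiset.
    have e : ((Γ₁.types 0).toList : Multiset Ty) = Γ₁.types 0 := Multiset.coe_toList _
    exact .app (.lam hm e) (by rwa [e])
  | cons a l ih =>
    obtain ⟨Γ₁, Γ₂, τ, rfl, rfl, hm, ha⟩ := h.sub_inv
    rw [List.length_cons, Nat.add_comm, ← lift_lift] at hm
    obtain ⟨Γ₃, Γ₄, L, τ, rfl, hτ, hm', hn⟩ := (ih hm).app_inv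
    cases hτ
    obtain ⟨Δ, rfl, hn'⟩ := hn.rename_inv
    rw [Ctx.types_add, Ctx.types_zero_rename_add_succ 0, add_zero] at ha
    rw [Ctx.drop_add, Ctx.drop_zero_rename_add_succ 0]
    have e : Δ.rename (· + 0) = Δ := Δ.rename_id
    rw [e, add_right_comm]
    exact .app (.sub hm' ha) hn'

/-- Arguments in call-by-name terms are literal bags, so substitution steps never act at a distance.
-/
theorem plug_eq_bag {l : List RTerm} {t : RTerm} (h : CBN true (plug l t)) : l = [] := by
  cases l with
  | nil => rfl
  | cons a l => exact nomatch h.sub_inv.1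

/-- Reduction preserves call-by-name terms, and the reverse of reduction preserves types. -/
theorem RStep.cbn_typed {m : RTerm} {r : Option RTerm} (hs : RStep m r) :
    ∀ {m' : RTerm}, r = some m' → ∀ {b : Bool}, CBN b m →
      CBN b m' ∧ ∀ (Γ : Ctx) (X : Ty ⊕ Multiset Ty), Typed Γ m' X → Typed Γ m X := by
  induction hs with
  | beta l m n =>
    rintro _ ⟨⟩ b hm
    obtain ⟨rfl, _⟩ := hm.app_inv
    exact ⟨cbn_beta hm, fun Γ X h => typed_beta h⟩
  | der_one l n => exact fun _ _ hm => absurd hm CBN.not_der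
  | der_zero l s _ => exact fun _ _ hm => absurd hm CBN.not_der
  | sub_subst l m r ps hs =>
    rintro _ ⟨⟩ b hm
    obtain ⟨rfl, hm', hl⟩ := hm.sub_inv
    obtain rfl := plug_eq_bag hl
    have e : m.rename (upr (· + 0)) = m := by
      rw [show upr (· + 0) = id from upr_id, rename_id]
    rw [List.length_nil, e] at hs
    refine ⟨hs.cbn hl.bag_inv.2 hm', fun Γ X h => ?_⟩
    obtain ⟨Γ₀, Δ, rfl, h₁, h₂⟩ := hs.typed hl.bag_inv.2 h
    have e : Δ.rename (· + 0) = Δ := Δ.rename_id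
    obtain ⟨τ, rfl⟩ := h₁.of_cbn hm'
    rw [e]
    exact .sub h₁ h₂
  | sub_zero l m ps _ => exact fun h => nomatch h
  | @lam m r _ ih =>
    intro m' hr b hm
    obtain ⟨n, rfl, rfl⟩ := Option.map_eq_some_iff.1 hr
    obtain ⟨rfl, hm'⟩ := hm.lam_inv
    obtain ⟨hn, ih⟩ := ih rfl hm'
    refine ⟨.lam hn, fun Γ X h => ?_⟩
    obtain ⟨Γ', L, τ, rfl, rfl, hL, h⟩ := h.lam_inv
    exact .lam (ih _ _ h) hL
  | appL n _ ih =>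
    intro m' hr b hm
    obtain ⟨n, rfl, rfl⟩ := Option.map_eq_some_iff.1 hr
    obtain ⟨rfl, hm', hn⟩ := hm.app_inv
    obtain ⟨hm', ih⟩ := ih rfl hm'
    refine ⟨.app hm' hn, fun Γ X h => ?_⟩
    obtain ⟨Γ₁, Γ₂, L, τ, rfl, rfl, h₁, h₂⟩ := h.app_inv
    exact .app (ih _ _ h₁) h₂
  | appR n _ ih =>
    intro m' hr b hm
    obtain ⟨n, rfl, rfl⟩ := Option.map_eq_some_iff.1 hr
    obtain ⟨rfl, hm', hn⟩ := hm.app_inv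
    obtain ⟨hn, ih⟩ := ih rfl hn
    refine ⟨.app hm' hn, fun Γ X h => ?_⟩
    obtain ⟨Γ₁, Γ₂, L, τ, rfl, rfl, h₁, h₂⟩ := h.app_inv
    exact .app h₁ (ih _ _ h₂)
  | @bag m r s _ ih =>
    intro m' hr b hm
    obtain ⟨n, rfl, rfl⟩ := Option.map_eq_some_iff.1 hr
    obtain ⟨rfl, hm'⟩ := hm.bag_inv
    obtain ⟨hn, ih⟩ := ih rfl (hm' m (Multiset.mem_cons_self m s))
    refine ⟨.bag (fun p hp => ?_), fun Γ X h => ?_⟩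
    · rcases Multiset.mem_cons.1 hp with rfl | hp
      · exact hn
      · exact hm' p (Multiset.mem_cons_of_mem hp)
    · obtain ⟨Γ₁, Γ₂, τ, L, rfl, rfl, h₁, h₂⟩ := h.cons_inv
      exact .cons (ih _ _ h₁) h₂
  | der _ _ => exact fun _ _ hm => absurd hm CBN.not_der
  | subL n _ ih =>
    intro m' hr b hm
    obtain ⟨n, rfl, rfl⟩ := Option.map_eq_some_iff.1 hr
    obtain ⟨rfl, hm', hn⟩ := hm.sub_inv
    obtain ⟨hm', ih⟩ := ih rfl hm'
    refine ⟨.sub hm' hn, fun Γ X h => ?_⟩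
    obtain ⟨Γ₁, Γ₂, τ, rfl, rfl, h₁, h₂⟩ := h.sub_inv
    exact .sub (ih _ _ h₁) h₂
  | subR n _ ih =>
    intro m' hr b hm
    obtain ⟨n, rfl, rfl⟩ := Option.map_eq_some_iff.1 hr
    obtain ⟨rfl, hm', hn⟩ := hm.sub_inv
    obtain ⟨hn, ih⟩ := ih rfl hn
    refine ⟨.sub hm' hn, fun Γ X h => ?_⟩
    obtain ⟨Γ₁, Γ₂, τ, rfl, rfl, h₁, h₂⟩ := h.sub_inv
    exact .sub h₁ (ih _ _ h₂)

theorem Reduces.cbn_typed {m n : RTerm} (h : Reduces m n) (hm : CBN false m) :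
    CBN false n ∧ ∀ (Γ : Ctx) (X : Ty ⊕ Multiset Ty), Typed Γ n X → Typed Γ m X := by
  induction h with
  | refl => exact ⟨hm, fun _ _ h => h⟩
  | tail _ hs ih =>
    obtain ⟨hn, h⟩ := hs.cbn_typed rfl ih.1
    exact ⟨hn, fun Γ X h' => ih.2 Γ X (h Γ X h')⟩

/-- The typing of an approximant gives a typing of the approximated term. -/
theorem Typed.dtyped {Γ : Ctx} {m : RTerm} {X : Ty ⊕ Multiset Ty} (h : Typed Γ m X) :
    ∀ M : DTerm, (Approx m M ∨ ∃ s, m = bag s ∧ ∀ n ∈ s, Approx n M) →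
      ∃ k, DTerm.DTyped k Γ M X := by
  induction h with
  | var i τ =>
    rintro M (h | ⟨s, e, _⟩)
    · generalize e : RTerm.var i = t at h
      cases h <;> cases mk_injective e
      exact ⟨0, .var i τ⟩
    · cases mk_injective e
  | @lam Γ m L τ _ hL ih =>
    rintro M (h | ⟨s, e, _⟩)
    · generalize e : RTerm.lam m = t at h
      cases h <;> cases mk_injective e
      obtain ⟨k, hk⟩ := ih _ (.inl ‹_›)
      exact ⟨_, .lam hk hL⟩
    · cases mk_injective e
  | @app Γ Δ m n L τ _ _ ihm ihn =>
    rintro M (h | ⟨s, e, _⟩)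
    · generalize e : RTerm.app m n = t at h
      cases h <;> cases mk_injective e
      obtain ⟨k, hk⟩ := ihm _ (.inl ‹_›)
      obtain ⟨l, hl⟩ := ihn _ (.inr ⟨_, rfl, ‹_›⟩)
      exact ⟨_, .app hk hl⟩
    · cases mk_injective e
  | @sub Γ Δ m n τ _ _ ihm ihn =>
    rintro M (h | ⟨s, e, _⟩)
    · generalize e : RTerm.sub m n = t at h
      cases h <;> cases mk_injective e
      obtain ⟨k, hk⟩ := ihm _ (.inl ‹_›)
      obtain ⟨l, hl⟩ := ihn _ (.inr ⟨_, rfl, ‹_›⟩)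
      exact ⟨_, .sub hk hl⟩
    · cases mk_injective e
  | nil => exact fun M _ => ⟨0, .nil M⟩
  | @cons Γ Δ m s τ L _ _ ihm ihs =>
    rintro M (h | ⟨t, e, h⟩)
    · exact nomatch h.cbn.bag_inv.1
    · cases mk_injective e
      obtain ⟨k, hk⟩ := ihm _ (.inl (h m (Multiset.mem_cons_self m s)))
      obtain ⟨l, hl⟩ := ihs _ (.inr ⟨s, rfl, fun n hn => h n (Multiset.mem_cons_of_mem hn)⟩)
      exact ⟨_, .cons hk hl⟩

/-! ### Normal forms are typable -/

/-- An enumeration of `ps` is cut according to the numbers of occurrences in the subterms. -/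
theorem LinSubst.exists {d : ℕ} {ps : Multiset RTerm} {m : RTerm}
    (h : m.occ d = Multiset.card ps) : ∃ r, LinSubst d ps m r := by
  have split : ∀ {a b : ℕ} {ps : Multiset RTerm}, a + b = Multiset.card ps →
      ∃ qs rs, ps = qs + rs ∧ a = Multiset.card qs ∧ b = Multiset.card rs := by
    intro a b ps h
    obtain ⟨l, rfl⟩ := Quot.exists_rep ps
    have h : a + b = l.length := h
    refine ⟨(l.take a : List RTerm), (l.drop a : List RTerm), ?_, ?_, ?_⟩
    · rw [Multiset.coe_add, List.take_append_drop]; rfl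
    · rw [Multiset.coe_card, List.length_take]; omega
    · rw [Multiset.coe_card, List.length_drop]; omega
  induction m using RTerm.induction generalizing d ps with
  | hvar i =>
    rw [occ_var] at h
    rcases lt_trichotomy i d with hi | rfl | hi
    · rw [if_neg hi.ne, eq_comm, Multiset.card_eq_zero] at h
      subst h
      exact ⟨_, .var_lt hi⟩
    · rw [if_pos rfl, eq_comm, Multiset.card_eq_one] at h
      obtain ⟨p, rfl⟩ := h
      exact ⟨_, .var_eq i p⟩
    · rw [if_neg hi.ne', eq_comm, Multiset.card_eq_zero] at h
      subst h
      obtain ⟨j, rfl⟩ := Nat.exists_eq_succ_of_ne_zero (Nat.ne_of_gt (Nat.zero_lt_of_lt hi))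
      exact ⟨_, .var_gt (Nat.le_of_lt_succ hi)⟩
  | hlam m ih =>
    rw [occ_lam] at h
    obtain ⟨r, hr⟩ := ih h
    exact ⟨_, hr.lam⟩
  | happ m n ihm ihn =>
    rw [occ_app] at h
    obtain ⟨qs, rs, rfl, hq, hr⟩ := split h
    obtain ⟨_, h₁⟩ := ihm hq
    obtain ⟨_, h₂⟩ := ihn hr
    exact ⟨_, h₁.app h₂⟩
  | hbag s ih =>
    suffices ∃ t, LinSubst d ps (bag s) (bag t) from this.imp' bag (fun _ h => h)
    induction s using Multiset.induction_on generalizing ps with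
    | empty =>
      rw [occ_bag, Multiset.map_zero, Multiset.sum_zero, eq_comm, Multiset.card_eq_zero] at h
      subst h
      exact ⟨0, .bag_nil d⟩
    | cons m s ihs =>
      rw [occ_bag, Multiset.map_cons, Multiset.sum_cons, ← occ_bag] at h
      obtain ⟨qs, rs, rfl, hq, hr⟩ := split h
      obtain ⟨r, h₁⟩ := ih m (Multiset.mem_cons_self m s) hq
      obtain ⟨t, h₂⟩ := ihs (fun n hn => ih n (Multiset.mem_cons_of_mem hn)) hr
      exact ⟨r ::ₘ t, h₁.bag_cons h₂⟩
  | hder m ih =>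
    rw [occ_der] at h
    obtain ⟨r, hr⟩ := ih h
    exact ⟨_, hr.der⟩
  | hsub m n ihm ihn =>
    rw [occ_sub] at h
    obtain ⟨qs, rs, rfl, hq, hr⟩ := split h
    obtain ⟨_, h₁⟩ := ihm hq
    obtain ⟨_, h₂⟩ := ihn hr
    exact ⟨_, h₁.sub h₂⟩

theorem LinSubst.step {m r : RTerm} {ps : Multiset RTerm} (h : LinSubst 0 ps m r) :
    RStep (RTerm.sub m (RTerm.bag ps)) (some r) := by
  refine RStep.sub_subst [] m r ps ?_
  have e : m.rename (upr (· + 0)) = m := by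
    rw [show upr (· + 0) = id from upr_id, rename_id]
  rwa [List.length_nil, e]

/-- If the cardinalities agree a substitution step exists; otherwise the term reduces to `∅`, which
also counts against normality. -/
theorem sub_bag_not_normal (m : RTerm) (ps : Multiset RTerm) : ¬ Normal (sub m (bag ps)) := by
  intro h
  by_cases hc : m.occ 0 = Multiset.card ps
  · obtain ⟨r, hr⟩ := LinSubst.exists hc
    exact h (some r) hr.step
  · exact h none (RStep.sub_zero [] m ps hc)

theorem Typed.exists_bag {s : Multiset RTerm} (h : ∀ m ∈ s, ∃ Γ τ, Typed Γ m (.inl τ)) :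
    ∃ Γ L, Typed Γ (bag s) (.inr L) := by
  induction s using Multiset.induction_on with
  | empty => exact ⟨_, _, .nil⟩
  | cons m s ih =>
    obtain ⟨Γ, τ, h₁⟩ := h m (Multiset.mem_cons_self m s)
    obtain ⟨Δ, L, h₂⟩ := ih (fun n hn => h n (Multiset.mem_cons_of_mem hn))
    exact ⟨_, _, .cons h₁ h₂⟩

/-- A normal call-by-name term is typable, with an arbitrary type if it is not an abstraction. -/
theorem CBN.typed_of_normal {b : Bool} {m : RTerm} (h : CBN b m) (hm : Normal m) :
    (b = false → ∃ Γ τ, Typed Γ m (.inl τ)) ∧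
    (b = false → (∀ n, m ≠ RTerm.lam n) → ∀ τ, ∃ Γ, Typed Γ m (.inl τ)) ∧
    (b = true → ∃ Γ L, Typed Γ m (.inr L)) := by
  induction h with
  | var i => exact ⟨fun _ => ⟨_, .base, .var i _⟩, fun _ _ τ => ⟨_, .var i τ⟩, nofun⟩
  | @lam m _ ih =>
    obtain ⟨Γ, τ, h⟩ := (ih (fun r hr => hm _ hr.lam)).1 rfl
    exact ⟨fun _ => ⟨_, _, .lam h (Multiset.coe_toList _)⟩, fun _ h => absurd rfl (h m), nofun⟩
  | @app m n _ _ ihm ihn =>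
    have key : ∀ τ, ∃ Γ, Typed Γ (RTerm.app m n) (.inl τ) := by
      intro τ
      -- The argument is typed first. The function is no abstraction, for otherwise there would be a
      -- β-redex, so it can be given the arrow type that these types dictate.
      obtain ⟨Δ, L, hn⟩ := (ihn (fun r hr => hm _ (hr.appR m))).2.2 rfl
      obtain ⟨Γ, h⟩ := (ihm (fun r hr => hm _ (hr.appL n))).2.1 rfl
        (fun m' e => hm _ (e ▸ RStep.beta [] m' n)) (.arr L.toList τ)
      exact ⟨_, .app h (by rwa [Multiset.coe_toList])⟩
    exact ⟨fun _ => ⟨_, _, (key .base).choose_spec⟩, fun _ _ => key, nofun⟩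
  | @sub m n _ hn _ _ =>
    cases hn
    exact absurd hm (sub_bag_not_normal _ _)
  | @bag s _ ih =>
    refine ⟨nofun, nofun, fun _ => ?_⟩
    refine Typed.exists_bag (fun n hn => (ih n hn (fun r hr => ?_)).1 rfl)
    obtain ⟨t, rfl⟩ := Multiset.exists_cons_of_mem hn
    exact hm _ (hr.bag t)

/-! ### Backward simulation -/

theorem Reduces.map {f : RTerm → RTerm}
    (hf : ∀ m m', RStep m (some m') → RStep (f m) (some (f m'))) {m m' : RTerm}
    (h : Reduces m m') : Reduces (f m) (f m') :=
  Relation.ReflTransGen.lift (p := fun m n => RStep m (some n)) f hf _ _ h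

theorem Reduces.lam {m m' : RTerm} (h : Reduces m m') : Reduces (RTerm.lam m) (RTerm.lam m') :=
  h.map (fun _ _ => RStep.lam)

theorem Reduces.appL {m m' : RTerm} (h : Reduces m m') (n : RTerm) :
    Reduces (app m n) (app m' n) :=
  h.map (f := fun m => app m n) (fun _ _ => RStep.appL n)

theorem Reduces.appR (m : RTerm) {n n' : RTerm} (h : Reduces n n') :
    Reduces (app m n) (app m n') :=
  h.map (fun _ _ => RStep.appR m)

theorem Reduces.subL {m m' : RTerm} (h : Reduces m m') (n : RTerm) :
    Reduces (sub m n) (sub m' n) :=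
  h.map (f := fun m => sub m n) (fun _ _ => RStep.subL n)

theorem Reduces.subR (m : RTerm) {n n' : RTerm} (h : Reduces n n') :
    Reduces (sub m n) (sub m n') :=
  h.map (fun _ _ => RStep.subR m)

theorem Reduces.bag_cons {m m' : RTerm} (h : Reduces m m') (s : Multiset RTerm) :
    Reduces (bag (m ::ₘ s)) (bag (m' ::ₘ s)) :=
  h.map (f := fun m => bag (m ::ₘ s)) (fun _ _ => RStep.bag s)

theorem exists_reduces_bag {P : RTerm → Prop} (t : Multiset RTerm)
    (h : ∀ n' ∈ t, ∃ n, P n ∧ Reduces n n') :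
    ∃ s, (∀ n ∈ s, P n) ∧ Reduces (bag s) (bag t) := by
  -- A step acts on one element of the bag; `w` holds the elements already reduced.
  suffices ∃ s, (∀ n ∈ s, P n) ∧ ∀ w, Reduces (bag (s + w)) (bag (t + w)) by
    obtain ⟨s, hs, hr⟩ := this
    exact ⟨s, hs, by simpa using hr 0⟩
  induction t using Multiset.induction_on with
  | empty => exact ⟨0, by simp, fun w => .refl⟩
  | cons n' t ih =>
    obtain ⟨s, hs, hr⟩ := ih (fun n hn => h n (Multiset.mem_cons_of_mem hn))
    obtain ⟨n, hn, hnr⟩ := h n' (Multiset.mem_cons_self n' t)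
    refine ⟨n ::ₘ s, fun p hp => ?_, fun w => ?_⟩
    · rcases Multiset.mem_cons.1 hp with rfl | hp
      · exact hn
      · exact hs p hp
    · rw [Multiset.cons_add, Multiset.cons_add]
      refine (hnr.bag_cons _).trans ?_
      rw [← Multiset.add_cons, ← Multiset.add_cons]
      exact hr _

theorem exists_map_of_forall {P : RTerm → Prop} {f : RTerm → RTerm} (t : Multiset RTerm)
    (h : ∀ n' ∈ t, ∃ n, n' = f n ∧ P n) : ∃ s : Multiset RTerm, t = s.map f ∧ ∀ n ∈ s, P n := by
  induction t using Multiset.induction_on with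
  | empty => exact ⟨0, rfl, by simp⟩
  | cons n' t ih =>
    obtain ⟨s, rfl, hs⟩ := ih (fun n hn => h n (Multiset.mem_cons_of_mem hn))
    obtain ⟨n, rfl, hn⟩ := h n' (Multiset.mem_cons_self _ _)
    exact ⟨n ::ₘ s, (Multiset.map_cons _ _ _).symm, by simpa using ⟨hn, hs⟩⟩

theorem Approx.of_rename {N : DTerm} {f : ℕ → ℕ} {n' : RTerm} (h : Approx n' (N.rename f)) :
    ∃ n, n' = n.rename f ∧ Approx n N := by
  induction N generalizing f n' with
  | var i => cases h; exact ⟨_, (rename_var i f).symm, .var i⟩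
  | lam M ih =>
    cases h with
    | lam h =>
      obtain ⟨m, rfl, h'⟩ := ih h
      exact ⟨_, (rename_lam m f).symm, .lam h'⟩
  | app M N ihM ihN =>
    cases h with
    | app h hs =>
      obtain ⟨m, rfl, h'⟩ := ihM h
      obtain ⟨s, rfl, hs'⟩ := exists_map_of_forall _ (fun n hn => ihN (hs n hn))
      exact ⟨RTerm.app m (bag s), by rw [rename_app, rename_bag], .app h' hs'⟩
  | sub M N ihM ihN =>
    cases h with
    | sub h hs =>
      obtain ⟨m, rfl, h'⟩ := ihM h
      obtain ⟨s, rfl, hs'⟩ := exists_map_of_forall _ (fun n hn => ihN (hs n hn))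
      exact ⟨RTerm.sub m (bag s), by rw [rename_sub, rename_bag], .sub h' hs'⟩

/-- Approximants of `M{N/x}` are linear substitutions of approximants of `N` in approximants of
`M`. -/
theorem Approx.of_psubst_single {M N : DTerm} {d : ℕ} {m' : RTerm}
    (h : Approx m' (M.psubst (DTerm.single d N))) :
    ∃ m s, Approx m M ∧ (∀ n ∈ s, Approx n N) ∧ LinSubst d s m m' := by
  -- Each element of an argument bag is traced back separately, and the bags of approximants of `N`
  -- that they consume are added up.
  have bag : ∀ {M : DTerm} {d : ℕ} (t : Multiset RTerm), (∀ n' ∈ t, ∃ m s, Approx m M ∧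
      (∀ n ∈ s, Approx n N) ∧ LinSubst d s m n') → ∃ u s, (∀ m ∈ u, Approx m M) ∧
      (∀ n ∈ s, Approx n N) ∧ LinSubst d s (RTerm.bag u) (RTerm.bag t) := by
    intro M d t ht
    induction t using Multiset.induction_on with
    | empty => exact ⟨0, 0, by simp, by simp, .bag_nil d⟩
    | cons n' t ih =>
      obtain ⟨u, s, hu, hs, h₁⟩ := ih (fun n hn => ht n (Multiset.mem_cons_of_mem hn))
      obtain ⟨m, s', hm, hs', h₂⟩ := ht n' (Multiset.mem_cons_self _ _)
      exact ⟨m ::ₘ u, s' + s, by simpa using ⟨hm, hu⟩,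
        fun n hn => (Multiset.mem_add.1 hn).elim (hs' n) (hs n), h₂.bag_cons h₁⟩
  induction M generalizing d m' with
  | var i =>
    rw [DTerm.psubst] at h
    rcases lt_trichotomy i d with hi | rfl | hi
    · rw [DTerm.single_lt _ hi] at h
      cases h
      exact ⟨_, 0, .var i, by simp, .var_lt hi⟩
    · rw [DTerm.single_self] at h
      obtain ⟨n, rfl, hn⟩ := h.of_rename
      exact ⟨_, {n}, .var i, by simpa using hn, .var_eq i n⟩
    · obtain ⟨j, rfl⟩ := Nat.exists_eq_succ_of_ne_zero (Nat.ne_of_gt (Nat.zero_lt_of_lt hi))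
      rw [DTerm.single_succ _ (Nat.le_of_lt_succ hi)] at h
      cases h
      exact ⟨_, 0, .var _, by simp, .var_gt (Nat.le_of_lt_succ hi)⟩
  | lam M ih =>
    rw [DTerm.psubst, DTerm.ups_single] at h
    cases h with
    | lam h =>
      obtain ⟨m, s, hm, hs, h⟩ := ih h
      exact ⟨_, s, .lam hm, hs, h.lam⟩
  | app M N ihM ihN =>
    cases h with
    | app h ht =>
      obtain ⟨m, s, hm, hs, h₁⟩ := ihM h
      obtain ⟨u, s', hu, hs', h₂⟩ := bag _ (fun n hn => ihN (ht n hn))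
      exact ⟨_, s + s', .app hm hu,
        fun n hn => (Multiset.mem_add.1 hn).elim (hs n) (hs' n), h₁.app h₂⟩
  | sub M N ihM ihN =>
    rw [DTerm.psubst, DTerm.ups_single] at h
    cases h with
    | sub h ht =>
      obtain ⟨m, s, hm, hs, h₁⟩ := ihM h
      obtain ⟨u, s', hu, hs', h₂⟩ := bag _ (fun n hn => ihN (ht n hn))
      exact ⟨_, s + s', .sub hm hu,
        fun n hn => (Multiset.mem_add.1 hn).elim (hs n) (hs' n), h₁.sub h₂⟩

/-- Undoes a β-step at a distance: the bag substituted inside the list context is a lift of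
approximants of `N`, hence can be moved outside as the argument. -/
theorem Approx.of_plug_sub {L : List DTerm} {M N : DTerm} {m' : RTerm}
    (h : Approx m' (DTerm.plug L (DTerm.sub M (N.lift L.length)))) :
    ∃ (l : List RTerm) (m : RTerm) (s : Multiset RTerm),
      m' = plug l (RTerm.sub m ((bag s).lift l.length)) ∧ (∀ n ∈ s, Approx n N) ∧
      Approx (plug l (RTerm.lam m)) (DTerm.plug L (DTerm.lam M)) := by
  induction L generalizing N m' with
  | nil =>
    rw [List.length_nil, DTerm.lift_zero] at h
    cases h with
    | @sub m _ _ s h hs => exact ⟨[], m, s, by rw [List.length_nil, lift_zero]; rfl, hs, .lam h⟩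
  | cons A L ih =>
    rw [List.length_cons, Nat.add_comm, ← DTerm.lift_lift] at h
    cases h with
    | @sub _ _ _ t h ht =>
      obtain ⟨l, m, s, rfl, hs, h'⟩ := ih h
      obtain ⟨s, rfl, hs'⟩ := exists_map_of_forall s (fun n hn => (hs n hn).of_rename)
      refine ⟨bag t :: l, m, s, ?_, hs', .sub h' ht⟩
      rw [List.length_cons, Nat.add_comm, ← lift_lift, lift.eq_1 1, rename_bag]
      rfl

/-- The approximant of `M` is built to fit `m'`, with bags of the right size, so `∅` never arises. A
step inside an argument is repeated for each element of its bag, possibly zero times. -/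
theorem Approx.of_step {M M' : DTerm} (hs : DTerm.Step M M') {m' : RTerm} (h : Approx m' M') :
    ∃ m, Approx m M ∧ Reduces m m' := by
  induction hs generalizing m' with
  | beta L M N =>
    obtain ⟨l, m, s, rfl, hs, h⟩ := h.of_plug_sub
    exact ⟨_, .app h hs, .single (.beta l m (bag s))⟩
  | subst M N =>
    rw [DTerm.inst_eq] at h
    obtain ⟨m, s, hm, hs, h⟩ := h.of_psubst_single
    exact ⟨_, .sub hm hs, .single h.step⟩
  | lam _ ih =>
    cases h with
    | lam h =>
      obtain ⟨m, hm, hr⟩ := ih h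
      exact ⟨_, .lam hm, hr.lam⟩
  | appL N _ ih =>
    cases h with
    | app h hs =>
      obtain ⟨m, hm, hr⟩ := ih h
      exact ⟨_, .app hm hs, hr.appL _⟩
  | appR M _ ih =>
    cases h with
    | app h hs =>
      obtain ⟨s, hs, hr⟩ := exists_reduces_bag _ (fun n hn => ih (hs n hn))
      exact ⟨_, .app h hs, .appR _ hr⟩
  | subL N _ ih =>
    cases h with
    | sub h hs =>
      obtain ⟨m, hm, hr⟩ := ih h
      exact ⟨_, .sub hm hs, hr.subL _⟩
  | subR M _ ih =>
    cases h with
    | sub h hs =>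
      obtain ⟨s, hs, hr⟩ := exists_reduces_bag _ (fun n hn => ih (hs n hn))
      exact ⟨_, .sub h hs, .subR _ hr⟩

theorem Approx.of_reduces {M M' : DTerm} (hs : DTerm.Reduces M M') {m' : RTerm}
    (h : Approx m' M') : ∃ m, Approx m M ∧ Reduces m m' := by
  induction hs using Relation.ReflTransGen.head_induction_on with
  | refl => exact ⟨m', h, .refl⟩
  | head hs _ ih =>
    obtain ⟨m₁, h₁, hr₁⟩ := ih
    obtain ⟨m, hm, hr⟩ := h₁.of_step hs
    exact ⟨m, hm, hr.trans hr₁⟩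

/-- A term with an approximant that has a normal form is typable. -/
theorem Approx.exists_dtyped {M : DTerm} {m n : RTerm} (hm : Approx m M) (hr : Reduces m n)
    (hn : Normal n) : ∃ k Γ τ, DTerm.DTyped k Γ M (.inl τ) := by
  obtain ⟨hc, ht⟩ := hr.cbn_typed hm.cbn
  obtain ⟨Γ, τ, h⟩ := (hc.typed_of_normal hn).1 rfl
  obtain ⟨k, hk⟩ := (ht _ _ h).dtyped M (.inl hm)
  exact ⟨k, Γ, τ, hk⟩

/-! ### Normal approximants of head normal forms -/

theorem normal_var (i : ℕ) : Normal (var i) := by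
  intro r h
  generalize e : var i = t at h
  cases h <;> cases mk_injective e

theorem normal_lam {m : RTerm} (h : Normal m) : Normal (lam m) := by
  intro r hr
  generalize e : lam m = t at hr
  cases hr <;> cases mk_injective e
  exact h _ ‹_›

theorem normal_bag_zero : Normal (bag 0) := by
  intro r h
  generalize e : bag 0 = t at h
  cases h with
  | bag => exact absurd (RShape.bag.inj (mk_injective e)).symm Multiset.cons_ne_zero
  | _ => cases mk_injective e

theorem normal_app {m n : RTerm} (hm : Normal m) (hn : Normal n)
    (h : ∀ l m', m ≠ plug l (lam m')) : Normal (app m n) := by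
  intro r hr
  generalize e : app m n = t at hr
  cases hr <;> cases mk_injective e
  · exact h _ _ rfl
  · exact hm _ ‹_›
  · exact hn _ ‹_›

/-- All arguments are approximated by the empty bag, whatever they contain. The last conjunct
excludes β-redexes at a distance when one more argument is added. -/
theorem _root_.DTerm.Neutral.exists_normal {y n : ℕ} {M : DTerm} (h : M.Neutral y n) :
    ∃ m, Approx m M ∧ Normal m ∧ ∀ l m', m ≠ plug l (lam m') := by
  induction h with
  | var =>
    refine ⟨_, .var y, normal_var y, fun l m' e => ?_⟩
    cases l <;> cases mk_injective e
  | app N _ ih =>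
    obtain ⟨m, hm, hn, h⟩ := ih
    refine ⟨_, .app (s := 0) hm (by simp), normal_app hn normal_bag_zero h, fun l m' e => ?_⟩
    cases l <;> cases mk_injective e

theorem _root_.DTerm.Hnf.exists_normal {j y n : ℕ} {M : DTerm} (h : M.Hnf j y n) :
    ∃ m, Approx m M ∧ Normal m := by
  induction h with
  | neutral h =>
    obtain ⟨m, hm, hn, _⟩ := h.exists_normal
    exact ⟨m, hm, hn⟩
  | lam _ ih =>
    obtain ⟨m, hm, hn⟩ := ih
    exact ⟨_, .lam hm, normal_lam hn⟩

end RTerm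

/-! ### The equivalence. -/

theorem mainTheorem8 (M : DTerm) : M.Meaningful ↔ M.taylorNF.Nonempty := by
  constructor
  · rintro ⟨T, hT⟩
    -- The identity has a normal approximant, which is pulled back to an approximant of `T⟨M⟩` and
    -- makes that term typable.
    obtain ⟨t, ht, hr⟩ := RTerm.Approx.of_reduces hT (.lam (.var 0))
    obtain ⟨k, Γ, τ, h⟩ := ht.exists_dtyped hr
      (RTerm.normal_lam (RTerm.normal_var 0))
    obtain ⟨k, Γ, τ, h⟩ := h.of_fill T
    -- The typing now concerns `M` itself; the test is no longer needed.
    obtain ⟨H, j, y, n, hMH, hH⟩ := h.exists_hnf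
    obtain ⟨n, hnH, hn⟩ := hH.exists_normal
    obtain ⟨m, hm, hr⟩ := hnH.of_reduces hMH
    exact ⟨n, hn, m, hm, hr⟩
  · rintro ⟨n, hn, m, hm, hr⟩
    obtain ⟨k, Γ, τ, h⟩ := hm.exists_dtyped hr hn
    obtain ⟨H, j, y, n, hMH, hH⟩ := h.exists_hnf
    exact hH.meaningful.of_reduces hMH
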